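/- Let $V$ be a countable set, $\mathcal E:V\times V\to[0,\infty)$ a symmetric function and $m:V\to(0,\infty)$. Write $x\sim y$ if $\mathcal E(x,y)>0$, and assume that every $x\in V$ has only finitely many neighbours $y\sim x$. For every function $f$ on $V$ put $$\tilde\Delta_m f(x)=\frac1{m(x)}\sum_{y\in V}\mathcal E(x,y)\,(f(x)-f(y)).$$ Let $\Delta_m$ be the Friedrichs extension in $\ell^2(V,m)$ of the restriction of $\tilde\Delta_m$ to the finitely supported functions. For $U\subset V$ let the Dirichlet Laplacian $\Delta_m^U$ be the Friedrichs extension in $\ell^2(U,m)$ of the operator $f\mapsto(\tilde\Delta_m\tilde f)|_U$ on the finitely supported functions $f$ on $U$, where $\tilde f$ is the extension of $f$ by $0$ to $V$. Let $(S_n)_{n\ge0}$ be a 1-dimensional decomposition of the graph: the sets $S_n$ are finite, they form a partition of $V$, and $x\in S_n$, $y\in S_k$, $\mathcal E(x,y)>0$ imply $|n-k|\le1$. Write $|x|=n$ if $x\in S_n$, $B_N=\bigcup_{0\le i\le N}S_i$, $B_N^c=V\setminus B_N$, and $$\deg_\pm(x)=\frac1{m(x)}\sum_{y\in S_{|x|\pm1}}\mathcal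 E(x,y)\qquad(S_{-1}=\emptyset).$$ Suppose that there are $n_0\in\mathbb N$ and real constants $a\ge0$ and $D$ such that $\deg_+(x)-\deg_-(x)\ge a$ and $\deg_+(x)+\deg_-(x)\le D$ for all $x\in B_{n_0}^c$. Put $\phi(x)=\bigl(D-\sqrt{D^2-a^2}\bigr)\mathbf 1_{B_{n_0}^c}(x)$. Then $\phi\ge0$ and there is a function $W:V\to(0,\infty)$ such that $$\tilde\Delta_m W(x)\ge\phi(x)\,W(x)\quad\text{for all }x\in V.$$ Moreover $$\inf\sigma\bigl(\Delta_m^{B_n^c}\bigr)\ge D-\sqrt{D^2-a^2}\quad\text{for all }n\ge n_0,\qquad \inf\sigma_{\rm ess}(\Delta_m)\ge D-\sqrt{D^2-a^2},$$ where $\inf\emptyset=+\infty$. -/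

import Mathlib

open scoped ENNReal Topology InnerProductSpace

noncomputable section

/-! ### Unbounded operators: Friedrichs extension, spectrum, essential spectrum -/

section Operators

variable {H : Type*} [NormedAddCommGroup H] [InnerProductSpace ℂ H]

/-- `T` is a non-negative symmetric operator. -/
structure IsNonnegSymmetric (T : H →ₗ.[ℂ] H) : Prop where
  symmetric : T.IsFormalAdjoint T
  nonneg : ∀ u : T.domain, 0 ≤ (inner ℂ (u : H) (T u)).re

/-- The quadratic form `u ↦ ⟨u, T u⟩` on the domain of `T`. -/
def quadForm (T : H →ₗ.[ℂ] H) (u : T.domain) : ℝ := (inner ℂ (u : H) (T u)).re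

theorem quadForm_add_le {T : H →ₗ.[ℂ] H} (hT : IsNonnegSymmetric T) (u v : T.domain) :
    quadForm T (u + v) ≤ 2 * quadForm T u + 2 * quadForm T v := by
  have h := hT.nonneg (u - v)
  simp only [quadForm, LinearPMap.map_add, LinearPMap.map_sub, Submodule.coe_add,
    Submodule.coe_sub, inner_add_left, inner_add_right, inner_sub_left, inner_sub_right,
    Complex.add_re, Complex.sub_re] at h ⊢
  linarith

theorem quadForm_smul (T : H →ₗ.[ℂ] H) (c : ℂ) (u : T.domain) :
    quadForm T (c • u) = ‖c‖ ^ 2 * quadForm T u := by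
  simp only [quadForm, LinearPMap.map_smul, Submodule.coe_smul, inner_smul_left,
    inner_smul_right, ← mul_assoc]
  rw [Complex.mul_conj', ← Complex.ofReal_pow, Complex.re_ofReal_mul]

/-- The form domain of the Friedrichs extension of `T`: the completion of the domain of `T` for
the norm `(⟨u, T u⟩ + ‖u‖²)^{1/2}`, realised inside `H` as the set of the limits in `H` of the
sequences in the domain of `T` that are Cauchy for this norm. -/
def formDomain (T : H →ₗ.[ℂ] H) (hT : IsNonnegSymmetric T) : Submodule ℂ H where
  carrier := {f | ∃ u : ℕ → T.domain, Filter.Tendsto (fun n => (u n : H)) Filter.atTop (𝓝 f) ∧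
    Filter.Tendsto (fun p : ℕ × ℕ => quadForm T (u p.1 - u p.2)) Filter.atTop (𝓝 0)}
  zero_mem' := ⟨fun _ => 0, by simp, by simp [quadForm]⟩
  add_mem' := by
    rintro f g ⟨u, hu, hu'⟩ ⟨v, hv, hv'⟩
    refine ⟨fun n => u n + v n, by simpa using hu.add hv, ?_⟩
    have h := (hu'.const_mul 2).add (hv'.const_mul 2)
    simp only [mul_zero, add_zero] at h
    refine squeeze_zero (fun p => hT.nonneg _) (fun p => ?_) h
    rw [add_sub_add_comm]
    exact quadForm_add_le hT _ _
  smul_mem' := by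
    rintro c f ⟨u, hu, hu'⟩
    refine ⟨fun n => c • u n, by simpa using hu.const_smul c, ?_⟩
    have h := hu'.const_mul (‖c‖ ^ 2)
    simp only [mul_zero] at h
    refine h.congr fun p => ?_
    rw [← smul_sub, quadForm_smul]

/-- The Friedrichs extension of the non-negative symmetric operator `T`: the restriction of the
adjoint `T†` to the intersection of its domain with the form domain. -/
def friedrichs [CompleteSpace H] (T : H →ₗ.[ℂ] H) (hT : IsNonnegSymmetric T) : H →ₗ.[ℂ] H :=
  T.adjoint.domRestrict (formDomain T hT)

/-- The spectrum of an unbounded operator `A`: the set of the `z` for which `A - z` does not have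
a bounded everywhere defined two-sided inverse `R`. -/
def opSpectrum (A : H →ₗ.[ℂ] H) : Set ℂ :=
  {z | ¬ ∃ R : H →L[ℂ] H,
    (∀ g : H, ∃ f : A.domain, (f : H) = R g ∧ A f - z • (f : H) = g) ∧
    ∀ f : A.domain, R (A f - z • (f : H)) = (f : H)}

/-- The eigenspace `ker (A - z)`. -/
def opEigenspace (A : H →ₗ.[ℂ] H) (z : ℂ) : Submodule ℂ A.domain :=
  LinearMap.ker (A.toFun - z • A.domain.subtype)

/-- The discrete spectrum of a self-adjoint operator: the eigenvalues of finite multiplicity that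
are isolated points of the spectrum. -/
def discreteSpectrum (A : H →ₗ.[ℂ] H) : Set ℂ :=
  {z | opEigenspace A z ≠ ⊥ ∧ FiniteDimensional ℂ (opEigenspace A z) ∧
    ∃ ε > 0, opSpectrum A ∩ Metric.ball z ε = {z}}

/-- The essential spectrum of a self-adjoint operator: the complement in the spectrum of the
discrete spectrum. -/
def essSpectrum (A : H →ₗ.[ℂ] H) : Set ℂ := opSpectrum A \ discreteSpectrum A

/-- The infimum of a set of spectral values (real numbers, for a self-adjoint operator), as an
extended real number; `inf ∅ = +∞`. -/
def specInf (s : Set ℂ) : EReal := ⨅ z ∈ s, (z.re : EReal)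

end Operators

/-! ### The weighted space `ℓ²(X, m)` -/

section WeightedL2

/-- The measure `A ↦ ∑_{x ∈ A} m x` on all the subsets of `X`. -/
def weightMeasure {X : Type*} (m : X → ℝ) : @MeasureTheory.Measure X ⊤ :=
  @MeasureTheory.Measure.sum X X ⊤ fun x =>
    ENNReal.ofReal (m x) • @MeasureTheory.Measure.dirac X ⊤ x

/-- The Hilbert space `ℓ²(X, m)` of complex functions, with `⟨f, g⟩ = ∑ conj (f x) * g x * m x`. -/
abbrev WeightedL2 {X : Type*} (m : X → ℝ) : Type _ :=
  @MeasureTheory.Lp X ℂ ⊤ _ 2 (weightMeasure m)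

variable {X : Type*} {m : X → ℝ}

theorem weightMeasure_singleton (m : X → ℝ) (x : X) :
    weightMeasure m {x} = ENNReal.ofReal (m x) := by
  let _ : MeasurableSpace X := ⊤
  rw [weightMeasure, MeasureTheory.Measure.sum_apply _ (MeasurableSet.singleton x),
    tsum_eq_single x]
  · simp
  · intro y hy
    simp [hy]

theorem weightMeasure_ae (hm : ∀ x, 0 < m x) {p : X → Prop}
    (h : ∀ᵐ x ∂(weightMeasure m), p x) (x : X) : p x := by
  by_contra hx
  have h1 : weightMeasure m {x} = 0 :=
    MeasureTheory.measure_mono_null (by rintro y rfl; exact hx) h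
  rw [weightMeasure_singleton] at h1
  exact absurd (ENNReal.ofReal_eq_zero.1 h1) (not_le.2 (hm x))

theorem WeightedL2.coe_add (hm : ∀ x, 0 < m x) (f g : WeightedL2 m) (x : X) :
    (f + g) x = f x + g x :=
  weightMeasure_ae hm (MeasureTheory.Lp.coeFn_add f g) x

theorem WeightedL2.coe_smul (hm : ∀ x, 0 < m x) (c : ℂ) (f : WeightedL2 m) (x : X) :
    (c • f) x = c * f x :=
  weightMeasure_ae hm (MeasureTheory.Lp.coeFn_smul c f) x

theorem WeightedL2.coe_zero (hm : ∀ x, 0 < m x) (x : X) : (0 : WeightedL2 m) x = 0 :=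
  weightMeasure_ae hm (MeasureTheory.Lp.coeFn_zero ℂ 2 (weightMeasure m)) x

theorem memLp_of_finite_support (m : X → ℝ) {f : X → ℂ} (hf : f.support.Finite) :
    MeasureTheory.MemLp f 2 (weightMeasure m) := by
  let _ : MeasurableSpace X := ⊤
  classical
  have h : f = fun x => ∑ y ∈ hf.toFinset, Set.indicator {y} (fun _ => f y) x := by
    funext x
    by_cases hx : f x = 0
    · rw [hx]
      refine (Finset.sum_eq_zero fun y hy => ?_).symm
      refine Set.indicator_of_notMem ?_ _
      rintro rfl
      simp [hx] at hy
    · rw [Finset.sum_eq_single x]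
      · simp
      · intro y _ hy
        exact Set.indicator_of_notMem (fun h => hy h.symm) _
      · intro h
        simp [hx] at h
  rw [h]
  refine MeasureTheory.memLp_finsetSum _ fun y _ => ?_
  refine MeasureTheory.memLp_indicator_const 2 (MeasurableSet.singleton y) _ (Or.inr ?_)
  rw [weightMeasure_singleton]
  exact ENNReal.ofReal_ne_top

/-- The finitely supported elements of `ℓ²(X, m)`. -/
def finSupp (hm : ∀ x, 0 < m x) : Submodule ℂ (WeightedL2 m) where
  carrier := {f | (Function.support fun x => f x).Finite}
  zero_mem' := by
    have h : (fun x => (0 : WeightedL2 m) x) = 0 := funext (WeightedL2.coe_zero hm)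
    simp only [Set.mem_ofPred_eq, h, Function.support_zero, Set.finite_empty]
  add_mem' := by
    intro f g hf hg
    refine (Set.Finite.union hf hg).subset fun x hx => ?_
    by_contra h
    simp only [Set.mem_union, Function.mem_support, not_or, not_not] at h
    exact hx ((WeightedL2.coe_add hm f g x).trans (by rw [h.1, h.2, add_zero]))
  smul_mem' := by
    intro c f hf
    refine Set.Finite.subset hf fun x hx => ?_
    by_contra h
    simp only [Function.mem_support, not_not] at h
    exact hx ((WeightedL2.coe_smul hm c f x).trans (by rw [h, mul_zero]))

/-- The operator in `ℓ²(X, m)` with domain the finitely supported functions that acts as the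
linear map `L` on functions, which is to preserve the finiteness of supports. -/
def minimalOp (hm : ∀ x, 0 < m x) (L : (X → ℂ) →ₗ[ℂ] (X → ℂ))
    (hL : ∀ f : X → ℂ, f.support.Finite → (L f).support.Finite) :
    WeightedL2 m →ₗ.[ℂ] WeightedL2 m where
  domain := finSupp hm
  toFun :=
    { toFun := fun f =>
        (memLp_of_finite_support m (hL (fun x => (f : WeightedL2 m) x) f.2)).toLp _
      map_add' := by
        intro f g
        rw [← MeasureTheory.MemLp.toLp_add]
        congr 1
        rw [← map_add]
        congr 1
        funext x
        exact WeightedL2.coe_add hm _ _ x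
      map_smul' := by
        intro c f
        rw [RingHom.id_apply, ← MeasureTheory.MemLp.toLp_const_smul]
        congr 1
        rw [← map_smul]
        congr 1
        funext x
        exact WeightedL2.coe_smul hm _ _ x }

theorem minimalOp_apply (hm : ∀ x, 0 < m x) (L : (X → ℂ) →ₗ[ℂ] (X → ℂ))
    (hL : ∀ f : X → ℂ, f.support.Finite → (L f).support.Finite)
    (f : (minimalOp hm L hL).domain) (x : X) :
    (minimalOp hm L hL f) x = L (fun x => (f : WeightedL2 m) x) x :=
  weightMeasure_ae hm (MeasureTheory.MemLp.coeFn_toLp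
    (memLp_of_finite_support m (hL (fun x => (f : WeightedL2 m) x) f.2))) x

theorem WeightedL2.inner_eq_sum (hm : ∀ x, 0 < m x) (f g : WeightedL2 m) (s : Finset X)
    (hs : ∀ x ∉ s, f x = 0) :
    inner ℂ f g = ∑ x ∈ s, (m x : ℂ) * (starRingEnd ℂ (f x) * g x) := by
  let _ : MeasurableSpace X := ⊤
  rw [MeasureTheory.L2.inner_def,
    ← MeasureTheory.setIntegral_eq_integral_of_forall_compl_eq_zero (s := (s : Set X)),
    MeasureTheory.setIntegral_finset s (MeasureTheory.L2.integrable_inner f g).integrableOn]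
  · refine Finset.sum_congr rfl fun x _ => ?_
    rw [MeasureTheory.measureReal_def, weightMeasure_singleton,
      ENNReal.toReal_ofReal (hm x).le, Complex.real_smul, RCLike.inner_apply']
  · intro x hx
    rw [hs x (by simpa using hx), inner_zero_left]

theorem minimalOp_isNonnegSymmetric (hm : ∀ x, 0 < m x) (L : (X → ℂ) →ₗ[ℂ] (X → ℂ))
    (hL : ∀ f : X → ℂ, f.support.Finite → (L f).support.Finite)
    (q : (X → ℂ) → (X → ℂ) → ℂ)
    (hq : ∀ f g : X → ℂ, f.support.Finite → g.support.Finite → ∀ s : Finset X,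
      (∀ x ∉ s, f x = 0) → ∑ x ∈ s, (m x : ℂ) * (starRingEnd ℂ (f x) * L g x) = q f g)
    (hq_symm : ∀ f g, starRingEnd ℂ (q f g) = q g f) (hq_nonneg : ∀ f, 0 ≤ (q f f).re) :
    IsNonnegSymmetric (minimalOp hm L hL) := by
  have key : ∀ f g : (minimalOp hm L hL).domain, inner ℂ (f : WeightedL2 m)
      (minimalOp hm L hL g) = q (fun x => (f : WeightedL2 m) x) (fun x => (g : WeightedL2 m) x) := by
    intro f g
    have hf : (Function.support fun x => (f : WeightedL2 m) x).Finite := f.2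
    have hg : (Function.support fun x => (g : WeightedL2 m) x).Finite := g.2
    have h0 : ∀ x ∉ hf.toFinset, (f : WeightedL2 m) x = 0 := fun x hx => by
      by_contra h0
      exact hx (by simpa using h0)
    rw [← hq _ _ hf hg hf.toFinset h0, WeightedL2.inner_eq_sum hm _ _ hf.toFinset h0]
    simp only [minimalOp_apply]
  refine ⟨fun f g => ?_, fun f => ?_⟩
  · rw [← inner_conj_symm, key, key, hq_symm]
  · rw [key]
    exact hq_nonneg _

end WeightedL2

/-! ### Weighted graphs -/

/-- A locally finite weighted graph with vertex set `V`, symmetric edge weights `E x y ≥ 0`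
(`x` and `y` are neighbours when `E x y > 0`) and vertex weights `m x > 0`. -/
structure WeightedGraph (V : Type*) where
  E : V → V → ℝ
  m : V → ℝ
  E_symm : ∀ x y, E x y = E y x
  E_nonneg : ∀ x y, 0 ≤ E x y
  m_pos : ∀ x, 0 < m x
  locallyFinite : ∀ x, {y | 0 < E x y}.Finite

namespace WeightedGraph

variable {V : Type*} (G : WeightedGraph V)

/-- The finite set of the neighbours of `x`. -/
def nbr (x : V) : Finset V := (G.locallyFinite x).toFinset

/-- The algebraic Laplacian `(1 / m x) * ∑_y E x y * (f x - f y)` on all functions. -/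
def algLaplacian {F : Type*} [AddCommGroup F] [Module ℝ F] (f : V → F) (x : V) : F :=
  (G.m x)⁻¹ • ∑ y ∈ G.nbr x, G.E x y • (f x - f y)

/-- Extension by zero of a function on `U`. -/
def extendZero (U : Set V) : (U → ℂ) →ₗ[ℂ] (V → ℂ) := Function.ExtendByZero.linearMap ℂ Subtype.val

/-- The algebraic Laplacian as a linear map on complex functions. -/
def lapLinear : (V → ℂ) →ₗ[ℂ] (V → ℂ) where
  toFun f := G.algLaplacian f
  map_add' f g := by
    funext x
    simp only [algLaplacian, Pi.add_apply, ← smul_add, ← Finset.sum_add_distrib]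
    congr 2
    funext y
    congr 1
    ring
  map_smul' c f := by
    funext x
    simp only [algLaplacian, Pi.smul_apply, RingHom.id_apply]
    have h : ∀ y ∈ G.nbr x, G.E x y • (c • f x - c • f y) = c • (G.E x y • (f x - f y)) :=
      fun y _ => by rw [← smul_sub, smul_comm]
    rw [Finset.sum_congr rfl h, ← Finset.smul_sum, smul_comm]

/-- The map `f ↦ (Δ f̃)|_U` on functions on `U`, where `f̃` is the extension of `f` by zero. -/
def dirichletLinear (U : Set V) : (U → ℂ) →ₗ[ℂ] (U → ℂ) :=
  LinearMap.funLeft ℂ ℂ (Subtype.val : U → V) ∘ₗ G.lapLinear ∘ₗ extendZero U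

theorem E_eq_zero {x y : V} (h : y ∉ G.nbr x) : G.E x y = 0 := by
  have : ¬ 0 < G.E x y := by simpa [nbr] using h
  exact le_antisymm (not_lt.1 this) (G.E_nonneg x y)

theorem lapLinear_support (f : V → ℂ) (hf : f.support.Finite) :
    (G.lapLinear f).support.Finite := by
  classical
  refine (hf.toFinset ∪ hf.toFinset.biUnion G.nbr).finite_toSet.subset fun x hx => ?_
  by_contra h
  simp only [Finset.coe_union, Set.mem_union, Finset.mem_coe, Finset.mem_biUnion,
    Set.Finite.mem_toFinset, Function.mem_support, not_or, not_exists, not_and, not_not] at h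
  refine hx ?_
  change (G.m x)⁻¹ • ∑ y ∈ G.nbr x, G.E x y • (f x - f y) = 0
  rw [Finset.sum_eq_zero, smul_zero]
  intro y _
  by_cases hy : f y = 0
  · simp [h.1, hy]
  · rw [G.E_symm, G.E_eq_zero (h.2 y hy), zero_smul]

theorem extendZero_apply {U : Set V} (f : U → ℂ) (x : U) : extendZero U f x = f x :=
  Subtype.val_injective.extend_apply f 0 x

theorem extendZero_apply_of_notMem {U : Set V} (f : U → ℂ) {x : V} (hx : x ∉ U) :
    extendZero U f x = 0 :=
  Function.extend_apply' (f := (Subtype.val : U → V)) f 0 x (by rintro ⟨y, rfl⟩; exact hx y.2)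

theorem extendZero_support {U : Set V} (f : U → ℂ) (hf : f.support.Finite) :
    (extendZero U f).support.Finite := by
  refine (hf.image Subtype.val).subset fun x hx => ?_
  by_cases hU : x ∈ U
  · refine ⟨⟨x, hU⟩, ?_, rfl⟩
    have h := extendZero_apply f ⟨x, hU⟩
    rw [Function.mem_support, ← h]
    exact hx
  · exact absurd (extendZero_apply_of_notMem f hU) hx

theorem dirichletLinear_support (U : Set V) (f : U → ℂ) (hf : f.support.Finite) :
    (G.dirichletLinear U f).support.Finite :=
  (G.lapLinear_support _ (extendZero_support f hf)).preimage Subtype.val_injective.injOn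

/-- The sesquilinear form `Q(f, g) = (1/2) ∑_x ∑_y E x y * conj (f x - f y) * (g x - g y)`
for finitely supported functions. -/
def form (f g : V → ℂ) : ℂ :=
  (1 / 2 : ℂ) * ∑ᶠ p : V × V,
    (G.E p.1 p.2 : ℂ) * (starRingEnd ℂ (f p.1 - f p.2) * (g p.1 - g p.2))

theorem form_symm (f g : V → ℂ) : starRingEnd ℂ (G.form f g) = G.form g f := by
  have h := AddEquiv.map_finsum (starAddEquiv : ℂ ≃+ ℂ) fun p : V × V =>
    (G.E p.1 p.2 : ℂ) * (starRingEnd ℂ (f p.1 - f p.2) * (g p.1 - g p.2))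
  rw [form, map_mul, form]
  congr 1
  · simp [Complex.conj_ofNat]
  · refine Eq.trans h (finsum_congr fun p => ?_)
    change starRingEnd ℂ _ = _
    simp only [map_mul, Complex.conj_conj, Complex.conj_ofReal]
    ring

theorem form_nonneg (f : V → ℂ) : 0 ≤ (G.form f f).re := by
  have h : 0 ≤ (∑ᶠ p : V × V,
      (G.E p.1 p.2 : ℂ) * (starRingEnd ℂ (f p.1 - f p.2) * (f p.1 - f p.2))).re := by
    refine finsum_induction (fun z : ℂ => 0 ≤ z.re) (le_of_eq rfl)
      (fun x y hx hy => add_nonneg hx hy) fun p => ?_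
    rw [Complex.conj_mul', ← Complex.ofReal_pow, ← Complex.ofReal_mul, Complex.ofReal_re]
    exact mul_nonneg (G.E_nonneg _ _) (sq_nonneg _)
  have h2 : (1 / 2 : ℂ) = ((1 / 2 : ℝ) : ℂ) := by norm_num
  rw [form, h2, Complex.re_ofReal_mul]
  linarith

theorem green (f g : V → ℂ) (hf : f.support.Finite) (hg : g.support.Finite) (s : Finset V)
    (hs : ∀ x ∉ s, f x = 0) :
    ∑ x ∈ s, (G.m x : ℂ) * (starRingEnd ℂ (f x) * G.lapLinear g x) = G.form f g := by
  classical
  let u : Finset V := hf.toFinset ∪ hg.toFinset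
  let t : Finset V := s ∪ (u ∪ u.biUnion G.nbr)
  have hst : s ⊆ t := Finset.subset_union_left
  have hu : ∀ x ∉ u, f x = 0 ∧ g x = 0 := by
    intro x hx
    simpa [u] using hx
  have hut : ∀ x ∉ t, x ∉ u := fun x hx h =>
    hx (Finset.mem_union_right _ (Finset.mem_union_left _ h))
  have hnt : ∀ x ∉ t, ∀ y ∈ u, G.E y x = 0 := fun x hx y hy => by
    refine G.E_eq_zero fun h => hx ?_
    exact Finset.mem_union_right _ (Finset.mem_union_right _ (Finset.mem_biUnion.2 ⟨y, hy, h⟩))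
  rw [Finset.sum_subset hst fun x _ hx => by simp [hs x hx]]
  have h1 : ∀ x ∈ t, (G.m x : ℂ) * (starRingEnd ℂ (f x) * G.lapLinear g x) =
      ∑ y ∈ t, (G.E x y : ℂ) * (starRingEnd ℂ (f x) * (g x - g y)) := by
    intro x _
    by_cases hx : x ∈ u
    · have hm : (G.m x : ℂ) ≠ 0 := Complex.ofReal_ne_zero.2 (G.m_pos x).ne'
      have hl : G.lapLinear g x = (G.m x : ℂ)⁻¹ * ∑ y ∈ t, (G.E x y : ℂ) * (g x - g y) := by
        change (G.m x)⁻¹ • ∑ y ∈ G.nbr x, G.E x y • (g x - g y) = _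
        rw [Complex.real_smul, Complex.ofReal_inv]
        congr 1
        have hnx : G.nbr x ⊆ t := fun y hy => by
          by_contra h
          have h2 := hnt y h x hx
          have h3 : 0 < G.E x y := by simpa [nbr] using hy
          exact h3.ne' h2
        rw [← Finset.sum_subset hnx fun y _ hy => by simp [G.E_eq_zero hy]]
        exact Finset.sum_congr rfl fun y _ => Complex.real_smul
      rw [hl, mul_left_comm, mul_inv_cancel_left₀ hm, Finset.mul_sum]
      exact Finset.sum_congr rfl fun y _ => by ring
    · simp [(hu x hx).1]
  rw [Finset.sum_congr rfl h1]
  have h2 : G.form f g = (1 / 2 : ℂ) * ∑ x ∈ t, ∑ y ∈ t,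
      (G.E x y : ℂ) * (starRingEnd ℂ (f x - f y) * (g x - g y)) := by
    rw [form, ← Finset.sum_product', finsum_eq_sum_of_support_subset]
    intro p hp
    by_contra h
    simp only [Finset.coe_product, Set.mem_prod, Finset.mem_coe] at h
    refine hp ?_
    by_cases h3 : p.1 ∈ u
    · have h4 : p.2 ∉ t := fun h4 => h
        ⟨Finset.mem_union_right _ (Finset.mem_union_left _ h3), h4⟩
      simp [hnt _ h4 _ h3]
    · by_cases h4 : p.2 ∈ u
      · have h5 : p.1 ∉ t := fun h5 => h
          ⟨h5, Finset.mem_union_right _ (Finset.mem_union_left _ h4)⟩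
        simp [G.E_symm p.1, hnt _ h5 _ h4]
      · simp [hu _ h3, hu _ h4]
  have h3 : ∑ x ∈ t, ∑ y ∈ t, (G.E x y : ℂ) * (starRingEnd ℂ (f y) * (g x - g y)) =
      -∑ x ∈ t, ∑ y ∈ t, (G.E x y : ℂ) * (starRingEnd ℂ (f x) * (g x - g y)) := by
    rw [Finset.sum_comm, ← Finset.sum_neg_distrib]
    refine Finset.sum_congr rfl fun x _ => ?_
    rw [← Finset.sum_neg_distrib]
    refine Finset.sum_congr rfl fun y _ => ?_
    rw [G.E_symm y x]
    ring
  have h4 : ∑ x ∈ t, ∑ y ∈ t, (G.E x y : ℂ) * (starRingEnd ℂ (f x - f y) * (g x - g y)) =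
      ∑ x ∈ t, ∑ y ∈ t, (G.E x y : ℂ) * (starRingEnd ℂ (f x) * (g x - g y)) -
      ∑ x ∈ t, ∑ y ∈ t, (G.E x y : ℂ) * (starRingEnd ℂ (f y) * (g x - g y)) := by
    simp only [← Finset.sum_sub_distrib]
    refine Finset.sum_congr rfl fun x _ => Finset.sum_congr rfl fun y _ => ?_
    rw [map_sub]
    ring
  rw [h2, h4, h3]
  ring

theorem green_dirichlet (U : Set V) (f g : U → ℂ) (hf : f.support.Finite)
    (hg : g.support.Finite) (s : Finset U) (hs : ∀ x ∉ s, f x = 0) :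
    ∑ x ∈ s, (G.m x : ℂ) * (starRingEnd ℂ (f x) * G.dirichletLinear U g x) =
      G.form (extendZero U f) (extendZero U g) := by
  rw [← G.green _ _ (extendZero_support f hf) (extendZero_support g hg)
    (s.map (Function.Embedding.subtype _)), Finset.sum_map]
  · refine Finset.sum_congr rfl fun x _ => ?_
    simp only [Function.Embedding.subtype_apply, extendZero_apply]
    rfl
  · intro x hx
    by_cases hU : x ∈ U
    · refine (extendZero_apply f ⟨x, hU⟩).trans (hs _ fun h => hx ?_)
      exact Finset.mem_map.2 ⟨⟨x, hU⟩, h, rfl⟩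
    · exact extendZero_apply_of_notMem f hU

/-- The Laplacian on the finitely supported functions on `V`. -/
def minLaplacian : WeightedL2 G.m →ₗ.[ℂ] WeightedL2 G.m :=
  minimalOp G.m_pos G.lapLinear G.lapLinear_support

theorem minLaplacian_isNonnegSymmetric : IsNonnegSymmetric G.minLaplacian :=
  minimalOp_isNonnegSymmetric _ _ _ G.form G.green G.form_symm G.form_nonneg

/-- The Laplacian `Δ_m`, the Friedrichs extension of its restriction to the finitely supported
functions. -/
def laplacian : WeightedL2 G.m →ₗ.[ℂ] WeightedL2 G.m :=
  friedrichs G.minLaplacian G.minLaplacian_isNonnegSymmetric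

/-- The Dirichlet Laplacian of `U` on the finitely supported functions on `U`. -/
def minDirichletLaplacian (U : Set V) :
    WeightedL2 (fun x : U => G.m x) →ₗ.[ℂ] WeightedL2 (fun x : U => G.m x) :=
  minimalOp (fun x => G.m_pos x) (G.dirichletLinear U) (G.dirichletLinear_support U)

theorem minDirichletLaplacian_isNonnegSymmetric (U : Set V) :
    IsNonnegSymmetric (G.minDirichletLaplacian U) :=
  minimalOp_isNonnegSymmetric _ _ _ (fun f g => G.form (extendZero U f) (extendZero U g))
    (G.green_dirichlet U) (fun _ _ => G.form_symm _ _) (fun _ => G.form_nonneg _)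

/-- The Dirichlet Laplacian `Δ_m^U`, a self-adjoint operator in `ℓ²(U, m)`. -/
def dirichletLaplacian (U : Set V) :
    WeightedL2 (fun x : U => G.m x) →ₗ.[ℂ] WeightedL2 (fun x : U => G.m x) :=
  friedrichs (G.minDirichletLaplacian U) (G.minDirichletLaplacian_isNonnegSymmetric U)

/-- A 1-dimensional decomposition of the graph: a partition of the vertices into finite sets
`S 0, S 1, …` such that neighbours lie in the same or in consecutive sets. -/
structure OneDimDecomposition where
  S : ℕ → Finset V
  partition : ∀ x, ∃! n, x ∈ S n
  edge : ∀ n k x y, x ∈ S n → y ∈ S k → 0 < G.E x y → n ≤ k + 1 ∧ k ≤ n + 1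

namespace OneDimDecomposition

variable {G} (P : G.OneDimDecomposition)

/-- `|x|`, the index `n` with `x ∈ S n`. -/
def level (x : V) : ℕ := (P.partition x).choose

/-- `B_N = S 0 ∪ … ∪ S N`. -/
def ball (N : ℕ) : Set V := ⋃ i ∈ Finset.Icc 0 N, (P.S i : Set V)

/-- `deg₊ x = (1 / m x) * ∑_{y ∈ S (|x| + 1)} E x y`. -/
def degPlus (x : V) : ℝ := (∑ y ∈ P.S (P.level x + 1), G.E x y) / G.m x

/-- `deg₋ x = (1 / m x) * ∑_{y ∈ S (|x| - 1)} E x y`, which is `0` when `|x| = 0`. -/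
def degMinus (x : V) : ℝ :=
  if P.level x = 0 then 0 else (∑ y ∈ P.S (P.level x - 1), G.E x y) / G.m x

end OneDimDecomposition

end WeightedGraph

end

/-! The bound comes from a positive radial supersolution. Let `W` be `1` on the ball and `t ^ (|x| -
n₀)` outside. Edges inside a single `S n` contribute nothing to the Laplacian of `W`, so outside the
ball `ΔW / W = deg₊ (1 - t) + deg₋ (1 - t⁻¹)`. For `t = √((D - a) / (D + a))` this is a combination
of `deg₊ + deg₋` and `deg₊ - deg₋` with coefficients of signs `≤ 0` and `≥ 0`, and the two
hypotheses bound it below by exactly `D - √(D² - a²)` (`exists_decay_rate`,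
`algLaplacian_geometric`).

A supersolution controls energy: if `ΔW ≥ c W` on the support of `f`, then `⟨f, Δf⟩ ≥ c ‖f‖²`
(`le_re_sum_lapLinear`, an argument of Barta or Allegretto–Piepenbrink type).

To pass to spectra, let `J` be the map into `H` from the completion of the domain in the form norm.
The Friedrichs extension `A` satisfies `(A + 1)⁻¹ = J J†`. An energy bound on the whole domain says
`‖J‖² ≤ (1 + c)⁻¹`, which makes `1 - (z + 1) J J†` coercive, hence invertible, when `Re z < c`. For
the essential spectrum the energy bound holds only for functions that vanish on a finite ball. These
have finite codimension, so `J J†` is a finite rank perturbation of an operator bounded by `(1 +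
c)⁻¹`, and below `c` there are only finitely many eigenvalues, each of finite multiplicity. -/

noncomputable section

/-! ### The Friedrichs extension and its resolvent through the form completion. -/

section AbstractOperators

variable {H : Type*} [NormedAddCommGroup H] [InnerProductSpace ℂ H]

/-- A Hilbert space `E` in which the domain of `T` with the inner product `⟨u, v⟩ + ⟨u, T v⟩` is
embedded densely, together with the continuous extension of the inclusion of the domain. -/
structure FormCompletion (T : H →ₗ.[ℂ] H) (E : Type*) [NormedAddCommGroup E]
    [InnerProductSpace ℂ E] where
  embed : T.domain →ₗ[ℂ] E
  toBase : E →L[ℂ] H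
  denseRange_embed : DenseRange embed
  inner_embed : ∀ u v : T.domain,
    inner ℂ (embed u) (embed v) = inner ℂ (u : H) (v : H) + inner ℂ (u : H) (T v)
  toBase_embed : ∀ u, toBase (embed u) = (u : H)

/-- The domain of `T`, to be equipped with the form norm. -/
def FormNormedDomain (T : H →ₗ.[ℂ] H) (_ : IsNonnegSymmetric T) : Type _ := T.domain

namespace FormNormedDomain

variable {T : H →ₗ.[ℂ] H} {hT : IsNonnegSymmetric T}

instance : AddCommGroup (FormNormedDomain T hT) := inferInstanceAs (AddCommGroup T.domain)

instance : Module ℂ (FormNormedDomain T hT) := inferInstanceAs (Module ℂ T.domain)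

/-- The identity map from the domain of `T`. -/
def ofDomain : T.domain →ₗ[ℂ] FormNormedDomain T hT := LinearMap.id (R := ℂ) (M := T.domain)

/-- The identity map to the domain of `T`. -/
def toDomain : FormNormedDomain T hT →ₗ[ℂ] T.domain := LinearMap.id (R := ℂ) (M := T.domain)

/-- The inner product `⟨u, v⟩ + ⟨u, T v⟩`. -/
@[reducible]
def core : InnerProductSpace.Core ℂ (FormNormedDomain T hT) where
  inner u v := inner ℂ (toDomain u : H) (toDomain v : H) +
    inner ℂ (toDomain u : H) (T (toDomain v))
  conj_inner_symm u v := by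
    rw [map_add, inner_conj_symm, inner_conj_symm, hT.symmetric]
  re_inner_nonneg u := by
    have h := hT.nonneg (toDomain u)
    rw [map_add, inner_self_eq_norm_sq]
    exact add_nonneg (sq_nonneg _) h
  add_left u v w := by
    simp only [map_add, Submodule.coe_add, inner_add_left]
    ring
  smul_left u v r := by
    simp only [map_smul, Submodule.coe_smul, inner_smul_left]
    ring
  definite u hu := by
    have h := hT.nonneg (toDomain u)
    have h2 := congrArg RCLike.re hu
    rw [map_add, inner_self_eq_norm_sq, map_zero] at h2
    have h3 : RCLike.re (inner ℂ (toDomain u : H) (T (toDomain u))) =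
      (inner ℂ (toDomain u : H) (T (toDomain u))).re := rfl
    have h4 : ‖(toDomain u : H)‖ = 0 := by
      rw [← sq_eq_zero_iff]
      nlinarith [sq_nonneg ‖(toDomain u : H)‖]
    have h5 : toDomain u = 0 := Subtype.ext (norm_eq_zero.1 h4)
    exact h5

instance : NormedAddCommGroup (FormNormedDomain T hT) :=
  @InnerProductSpace.Core.toNormedAddCommGroup ℂ _ _ _ _ core

instance : InnerProductSpace ℂ (FormNormedDomain T hT) :=
  InnerProductSpace.ofCore core.toCore

theorem inner_def (u v : FormNormedDomain T hT) : inner ℂ u v =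
    inner ℂ (toDomain u : H) (toDomain v : H) + inner ℂ (toDomain u : H) (T (toDomain v)) :=
  rfl

theorem norm_toDomain_le (u : FormNormedDomain T hT) : ‖(toDomain u : H)‖ ≤ ‖u‖ := by
  refine abs_le_of_sq_le_sq' ?_ (norm_nonneg _) |>.2
  rw [← inner_self_eq_norm_sq (𝕜 := ℂ) u, inner_def, map_add, inner_self_eq_norm_sq]
  have h := hT.nonneg (toDomain u)
  exact le_add_of_nonneg_right h

/-- The inclusion of the domain with the form norm into `H`. -/
def inclusion : FormNormedDomain T hT →L[ℂ] H :=
  LinearMap.mkContinuous (T.domain.subtype ∘ₗ toDomain) 1 fun u => by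
    rw [one_mul]
    exact norm_toDomain_le u

/-- The completion of the domain in the form norm. -/
def formCompletion [CompleteSpace H] :
    FormCompletion T (UniformSpace.Completion (FormNormedDomain T hT)) where
  embed := (UniformSpace.Completion.toComplL (𝕜 := ℂ) (E := FormNormedDomain T hT)).toLinearMap ∘ₗ
    ofDomain
  toBase := inclusion.extend (UniformSpace.Completion.toComplL (𝕜 := ℂ))
  denseRange_embed := UniformSpace.Completion.denseRange_coe (α := FormNormedDomain T hT)
  inner_embed u v := UniformSpace.Completion.inner_coe (𝕜 := ℂ) (E := FormNormedDomain T hT) u v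
  toBase_embed u := ContinuousLinearMap.extend_eq _
    (UniformSpace.Completion.denseRange_coe (α := FormNormedDomain T hT))
    (UniformSpace.Completion.isUniformInducing_coe _) (ofDomain u)

end FormNormedDomain

namespace FormCompletion

variable {T : H →ₗ.[ℂ] H} {E : Type*} [NormedAddCommGroup E] [InnerProductSpace ℂ E]
  (Φ : FormCompletion T E)

theorem inner_toBase (e : E) (v : T.domain) :
    inner ℂ (Φ.toBase e) ((v : H) + T v) = inner ℂ e (Φ.embed v) := by
  refine Φ.denseRange_embed.induction_on (p := fun e =>
    inner ℂ (Φ.toBase e) ((v : H) + T v) = inner ℂ e (Φ.embed v)) e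
    (isClosed_eq (by fun_prop) (by fun_prop)) fun u => ?_
  rw [Φ.toBase_embed, Φ.inner_embed, inner_add_right]

theorem norm_embed_sq (u : T.domain) : ‖Φ.embed u‖ ^ 2 = ‖(u : H)‖ ^ 2 + quadForm T u := by
  rw [← inner_self_eq_norm_sq (𝕜 := ℂ), Φ.inner_embed, map_add, inner_self_eq_norm_sq]
  rfl

theorem ext_embed {e e' : E} (h : ∀ v, inner ℂ e (Φ.embed v) = inner ℂ e' (Φ.embed v)) :
    e = e' :=
  Φ.denseRange_embed.eq_of_inner_left ℂ h

/-- The form norm dominates the norm of `H`, so sequences that converge in `H` and are Cauchy for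
the form are exactly the Cauchy sequences of the completion. -/
theorem mem_formDomain_iff [CompleteSpace E] (hT : IsNonnegSymmetric T) (f : H) :
    f ∈ formDomain T hT ↔ ∃ e, Φ.toBase e = f := by
  constructor
  · rintro ⟨u, hu, hu'⟩
    have hc : CauchySeq fun n => Φ.embed (u n) := by
      have h1 : Filter.Tendsto (fun p : ℕ × ℕ => ‖Φ.embed (u p.1 - u p.2)‖ ^ 2)
          Filter.atTop (𝓝 0) := by
        simp only [norm_embed_sq]
        have h2 := (cauchySeq_iff_tendsto_dist_atTop_0.1 hu.cauchySeq).pow 2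
        simpa [dist_eq_norm] using h2.add hu'
      rw [cauchySeq_iff_tendsto_dist_atTop_0]
      have h3 := h1.sqrt
      simpa [dist_eq_norm, Real.sqrt_sq] using h3
    obtain ⟨e, he⟩ := cauchySeq_tendsto_of_complete hc
    refine ⟨e, tendsto_nhds_unique ((Φ.toBase.continuous.tendsto e).comp he) ?_⟩
    simpa [Function.comp_def, Φ.toBase_embed] using hu
  · rintro ⟨e, rfl⟩
    obtain ⟨x, hx, hxe⟩ := mem_closure_iff_seq_limit.1 (Φ.denseRange_embed e)
    choose u hu using hx
    refine ⟨u, ?_, ?_⟩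
    · have := (Φ.toBase.continuous.tendsto e).comp hxe
      simpa [Function.comp_def, ← hu, Φ.toBase_embed] using this
    · have h2 := (cauchySeq_iff_tendsto_dist_atTop_0.1 hxe.cauchySeq).pow 2
      rw [zero_pow two_ne_zero] at h2
      refine squeeze_zero (fun p => hT.nonneg _) (fun p => ?_) h2
      rw [dist_eq_norm, ← hu, ← hu, ← map_sub, Φ.norm_embed_sq]
      exact le_add_of_nonneg_left (sq_nonneg _)

variable [CompleteSpace H] [CompleteSpace E]

/-- The resolvent `(A + 1)⁻¹` of the Friedrichs extension `A`. -/
def resolvent : H →L[ℂ] H := Φ.toBase ∘L Φ.toBase.adjoint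

/-- Testing `J J† g` against `v + T v` gives `⟨J† g, embed v⟩ = ⟨g, v⟩`. This puts `J J† g` in the
domain of `T†`, with value `g - J J† g` there. -/
theorem friedrichs_resolvent (hd : Dense (T.domain : Set H)) (hT : IsNonnegSymmetric T) (g : H) :
    ∃ f : (friedrichs T hT).domain, (f : H) = Φ.resolvent g ∧
      friedrichs T hT f + (f : H) = g := by
  have key : ∀ v : T.domain,
      inner ℂ (g - Φ.resolvent g) (v : H) = inner ℂ (Φ.resolvent g) (T v) := by
    intro v
    have h := Φ.inner_toBase (Φ.toBase.adjoint g) v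
    rw [ContinuousLinearMap.adjoint_inner_left, Φ.toBase_embed, inner_add_right] at h
    rw [inner_sub_left, ← h]
    change _ - inner ℂ (Φ.toBase (Φ.toBase.adjoint g)) _ = inner ℂ (Φ.toBase (Φ.toBase.adjoint g)) _
    ring
  have h1 : Φ.resolvent g ∈ T.adjoint.domain :=
    LinearPMap.mem_adjoint_domain_of_exists _ ⟨_, key⟩
  have h2 : Φ.resolvent g ∈ formDomain T hT := (Φ.mem_formDomain_iff hT _).2 ⟨_, rfl⟩
  refine ⟨⟨Φ.resolvent g, h2, h1⟩, rfl, ?_⟩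
  have h3 : friedrichs T hT ⟨Φ.resolvent g, h2, h1⟩ = T.adjoint ⟨Φ.resolvent g, h1⟩ :=
    LinearPMap.domRestrict_apply rfl
  rw [h3, LinearPMap.adjoint_apply_eq hd _ key]
  exact sub_add_cancel _ _

theorem resolvent_friedrichs (hd : Dense (T.domain : Set H)) (hT : IsNonnegSymmetric T)
    (f : (friedrichs T hT).domain) :
    Φ.resolvent (friedrichs T hT f + (f : H)) = (f : H) := by
  obtain ⟨e, he⟩ := (Φ.mem_formDomain_iff hT f).1 f.2.1
  have h3 : friedrichs T hT f = T.adjoint ⟨f, f.2.2⟩ := LinearPMap.domRestrict_apply rfl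
  have h : Φ.toBase.adjoint (friedrichs T hT f + (f : H)) = e := by
    refine Φ.ext_embed fun v => ?_
    rw [ContinuousLinearMap.adjoint_inner_left, Φ.toBase_embed, ← Φ.inner_toBase, inner_add_left,
      h3, LinearPMap.adjoint_isFormalAdjoint hd, he, inner_add_right, add_comm]
  change Φ.toBase (Φ.toBase.adjoint _) = _
  rw [h, he]

/-- Writing `A - z = (A + 1) - (z + 1)` and `R = (A + 1)⁻¹`, the inverse of `A - z` is `R (1 - (z +
1) R)⁻¹`. Spectral questions thus become questions about a bounded operator. -/
theorem notMem_opSpectrum (hd : Dense (T.domain : Set H)) (hT : IsNonnegSymmetric T) {z : ℂ}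
    (hz : IsUnit (1 - (z + 1) • Φ.resolvent)) : z ∉ opSpectrum (friedrichs T hT) := by
  obtain ⟨S, hS1, hS2⟩ := isUnit_iff_exists.1 hz
  have hS1' : ∀ g, S g - (z + 1) • Φ.resolvent (S g) = g := fun g => by
    simpa using congrArg (fun B : H →L[ℂ] H => B g) hS1
  have hS2' : ∀ g, S (g - (z + 1) • Φ.resolvent g) = g := fun g => by
    simpa using congrArg (fun B : H →L[ℂ] H => B g) hS2
  simp only [opSpectrum, Set.mem_ofPred_eq, not_not]
  refine ⟨Φ.resolvent ∘L S, fun g => ?_, fun f => ?_⟩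
  · obtain ⟨f, hf, hf'⟩ := Φ.friedrichs_resolvent hd hT (S g)
    refine ⟨f, hf, ?_⟩
    have h := hS1' g
    rw [← hf, ← hf'] at h
    rw [← h]
    module
  · have h := Φ.resolvent_friedrichs hd hT f
    have h2 := hS2' (friedrichs T hT f + (f : H))
    rw [h] at h2
    have h3 : friedrichs T hT f - z • (f : H) =
      friedrichs T hT f + (f : H) - (z + 1) • (f : H) := by module
    rw [h3, ContinuousLinearMap.comp_apply, h2, h]

end FormCompletion

/-! ### Operators `A A†` and their finite rank perturbations. -/

section BoundedOperators

variable {E : Type*} [NormedAddCommGroup E] [InnerProductSpace ℂ E] [CompleteSpace E]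
  [CompleteSpace H]

theorem norm_adjoint_sq_le {A : E →L[ℂ] H} {c : ℝ} (hc : 0 ≤ c)
    (hA : ∀ e, ‖A e‖ ^ 2 ≤ c * ‖e‖ ^ 2) (g : H) : ‖A.adjoint g‖ ^ 2 ≤ c * ‖g‖ ^ 2 := by
  have h1 : ‖A‖ ≤ √c := A.opNorm_le_bound (Real.sqrt_nonneg c) fun e => by
    rw [← Real.sqrt_sq (norm_nonneg e), ← Real.sqrt_mul hc]
    exact Real.le_sqrt_of_sq_le (hA e)
  have h2 : ‖A.adjoint g‖ ≤ √c * ‖g‖ :=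
    (A.adjoint.le_opNorm g).trans (by
      rw [LinearIsometryEquiv.norm_map]
      exact mul_le_mul_of_nonneg_right h1 (norm_nonneg _))
  calc ‖A.adjoint g‖ ^ 2 ≤ (√c * ‖g‖) ^ 2 := pow_le_pow_left₀ (norm_nonneg _) h2 2
    _ = c * ‖g‖ ^ 2 := by rw [mul_pow, Real.sq_sqrt hc]

theorem inner_comp_adjoint (A : E →L[ℂ] H) (g : H) :
    inner ℂ ((A ∘L A.adjoint) g) g = ((‖A.adjoint g‖ ^ 2 : ℝ) : ℂ) := by
  rw [ContinuousLinearMap.comp_apply, ← ContinuousLinearMap.adjoint_inner_right,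
    inner_self_eq_norm_sq_to_K]
  simp

/-- Coercivity: the real part of the form is `‖g‖² - Re z ‖A† g‖²`, at least `(1 - max 0 (c Re z))
‖g‖²`. The maximum with `0` covers `Re z ≤ 0`. -/
theorem isUnit_one_sub_smul_comp_adjoint {A : E →L[ℂ] H} {c : ℝ} (hc : 0 ≤ c)
    (hA : ∀ e, ‖A e‖ ^ 2 ≤ c * ‖e‖ ^ 2) {z : ℂ} (hz : z.re * c < 1) :
    IsUnit (1 - z • (A ∘L A.adjoint)) := by
  have hδ : 0 < 1 - max 0 (z.re * c) := sub_pos.2 (max_lt one_pos hz)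
  refine ContinuousLinearMap.isUnit_of_forall_le_norm_inner_map _
    (c := ⟨1 - max 0 (z.re * c), hδ.le⟩) hδ fun g => ?_
  refine le_trans ?_ (Complex.abs_re_le_norm _)
  refine le_trans ?_ (le_abs_self _)
  have h : inner ℂ ((1 - z • (A ∘L A.adjoint)) g) g =
      ((‖g‖ ^ 2 : ℝ) : ℂ) - starRingEnd ℂ z * ((‖A.adjoint g‖ ^ 2 : ℝ) : ℂ) := by
    rw [← inner_comp_adjoint, sub_apply, inner_sub_left,
      one_apply_eq_self, inner_self_eq_norm_sq_to_K, smul_apply,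
      inner_smul_left]
    simp
  rw [h, Complex.sub_re, Complex.ofReal_re, mul_comm (starRingEnd ℂ z), Complex.re_ofReal_mul,
    Complex.conj_re]
  have h1 := norm_adjoint_sq_le hc hA g
  change ‖g‖ ^ 2 * (1 - max 0 (z.re * c)) ≤ _
  rcases le_total z.re 0 with h0 | h0
  · have := mul_nonneg (sq_nonneg ‖A.adjoint g‖) (neg_nonneg.2 h0)
    have h2 := mul_nonneg (sq_nonneg ‖g‖) (le_max_left 0 (z.re * c))
    linarith
  · have := mul_le_mul_of_nonneg_right h1 h0
    have h2 := mul_le_mul_of_nonneg_left (le_max_right 0 (z.re * c)) (sq_nonneg ‖g‖)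
    linarith

/-- Fredholm alternative: solving `(S + K) x = g` reduces to inverting `1 + K S⁻¹` on the
finite-dimensional range of `K`, where injectivity implies surjectivity. -/
theorem isUnit_add_of_finiteDimensional_range {S K : H →L[ℂ] H} (hS : IsUnit S)
    [FiniteDimensional ℂ K.range] (h : ∀ g, (S + K) g = 0 → g = 0) : IsUnit (S + K) := by
  obtain ⟨R, hR1, hR2⟩ := isUnit_iff_exists.1 hS
  have hR1' : ∀ g, S (R g) = g := fun g => by
    simpa using congrArg (fun B : H →L[ℂ] H => B g) hR1
  rw [ContinuousLinearMap.isUnit_iff_bijective]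
  refine ⟨(injective_iff_map_eq_zero (S + K)).2 h, fun g => ?_⟩
  let M : K.range →ₗ[ℂ] K.range :=
    LinearMap.id + (K.toLinearMap.rangeRestrict ∘ₗ R.toLinearMap ∘ₗ K.range.subtype)
  have hM : ∀ w : K.range, (M w : H) = w + K (R w) := fun w => rfl
  have hinj : Function.Injective M := by
    refine (injective_iff_map_eq_zero M).2 fun w hw => ?_
    have h1 : (w : H) + K (R w) = 0 := by rw [← hM, hw]; rfl
    have h2 : R w = 0 := h _ (by rw [add_apply, hR1', h1])
    have h3 := hR1' w
    rw [h2, map_zero] at h3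
    exact Subtype.ext h3.symm
  obtain ⟨w, hw⟩ := LinearMap.injective_iff_surjective.1 hinj ⟨K (R g), ⟨R g, rfl⟩⟩
  have hw' : (w : H) + K (R w) = K (R g) := by rw [← hM, hw]
  refine ⟨R (g - w), ?_⟩
  rw [add_apply, hR1', map_sub, map_sub, ← hw']
  abel

/-- A finite rank perturbation of an operator `A A† ≤ c` has no more eigenvalues above `c` than
the dimension of the range of the perturbation: the images of eigenvectors are independent. -/
theorem linearIndependent_of_eigenvectors {B K : H →L[ℂ] H} {A : E →L[ℂ] H}
    (hB : B = A ∘L A.adjoint + K) {c : ℝ} (hc : 0 ≤ c) (hA : ∀ e, ‖A e‖ ^ 2 ≤ c * ‖e‖ ^ 2)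
    {ι : Type*} {v : ι → H} (hv : Orthonormal ℂ v) {w : ι → ℝ} (hw : ∀ i, c < w i)
    (hBv : ∀ i, B (v i) = (w i : ℂ) • v i) : LinearIndependent ℂ fun i => K (v i) := by
  rw [linearIndependent_iff']
  intro s a ha i hi
  set u : H := ∑ i ∈ s, a i • v i with hu
  have hK : K u = 0 := by
    rw [hu, map_sum, ← ha]
    simp only [map_smul]
  have hBu : B u = ∑ i ∈ s, (w i * a i) • v i := by
    rw [hu, map_sum]
    refine Finset.sum_congr rfl fun i _ => ?_
    rw [map_smul, hBv, smul_smul, mul_comm]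
  have h1 : (inner ℂ (B u) u).re = ∑ i ∈ s, w i * ‖a i‖ ^ 2 := by
    rw [hBu, hu, hv.inner_sum, Complex.re_sum]
    refine Finset.sum_congr rfl fun i _ => ?_
    rw [map_mul, Complex.conj_ofReal, mul_assoc, Complex.conj_mul', ← Complex.ofReal_pow,
      ← Complex.ofReal_mul, Complex.ofReal_re]
  have h2 : ‖u‖ ^ 2 = ∑ i ∈ s, ‖a i‖ ^ 2 := by
    rw [← inner_self_eq_norm_sq (𝕜 := ℂ), hu, hv.inner_sum, map_sum]
    refine Finset.sum_congr rfl fun i _ => ?_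
    rw [Complex.conj_mul', ← Complex.ofReal_pow]
    rfl
  have h3 : (inner ℂ (B u) u).re ≤ c * ‖u‖ ^ 2 := by
    rw [hB, add_apply, hK, add_zero, inner_comp_adjoint, Complex.ofReal_re]
    exact norm_adjoint_sq_le hc hA u
  rw [h1, h2, Finset.mul_sum] at h3
  -- On a vector `u` killed by `K` the form of `B` is at most `c ‖u‖²`, while a nonzero coefficient
  -- makes the weighted sum of the eigenvalues strictly larger.
  by_contra hne
  refine absurd h3 (not_le.2 (Finset.sum_lt_sum (fun j _ => ?_) ⟨i, hi, ?_⟩))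
  · exact mul_le_mul_of_nonneg_right (hw j).le (sq_nonneg _)
  · exact mul_lt_mul_of_pos_right (hw i) (pow_pos (norm_pos_iff.2 hne) 2)

end BoundedOperators

end AbstractOperators

/-! ### From lower bounds of the form to lower bounds of the spectra. -/

section FriedrichsSpectrum

variable {H : Type*} [NormedAddCommGroup H] [InnerProductSpace ℂ H]

theorem le_specInf {s : Set ℂ} {c : ℝ} (h : ∀ z ∈ s, c ≤ z.re) : (c : EReal) ≤ specInf s :=
  le_iInf₂ fun z hz => EReal.coe_le_coe_iff.2 (h z hz)

namespace FormCompletion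

variable {T : H →ₗ.[ℂ] H} {E : Type*} [NormedAddCommGroup E] [InnerProductSpace ℂ E]
  (Φ : FormCompletion T E)

theorem norm_toBase_sq_le {c : ℝ} (hc : 0 ≤ c) {F : Submodule ℂ T.domain}
    (hF : ∀ u ∈ F, c * ‖(u : H)‖ ^ 2 ≤ quadForm T u) {e : E}
    (he : e ∈ (F.map Φ.embed).topologicalClosure) :
    ‖Φ.toBase e‖ ^ 2 ≤ (1 + c)⁻¹ * ‖e‖ ^ 2 := by
  rw [← SetLike.mem_coe, Submodule.topologicalClosure_coe] at he
  have hclosed : IsClosed {e : E | ‖Φ.toBase e‖ ^ 2 ≤ (1 + c)⁻¹ * ‖e‖ ^ 2} :=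
    isClosed_le (by fun_prop) (by fun_prop)
  refine closure_minimal ?_ hclosed he
  rintro _ ⟨u, hu, rfl⟩
  rw [Set.mem_ofPred_eq, Φ.toBase_embed, Φ.norm_embed_sq, le_inv_mul_iff₀ (by linarith)]
  have := hF u hu
  linarith

/-- The projection onto the orthogonal complement kills the image of `F`, so it sends the dense
image of the domain into the projection of `N`, which is finite-dimensional and hence closed. -/
theorem finiteDimensional_map_orthogonal [CompleteSpace E] (F N : Submodule ℂ T.domain)
    [FiniteDimensional ℂ N] (hFN : F ⊔ N = ⊤) :
    FiniteDimensional ℂ (((F.map Φ.embed).topologicalClosure)ᗮ) := by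
  set M := (F.map Φ.embed).topologicalClosure with hM
  let L : Submodule ℂ E := (N.map Φ.embed).map Mᗮ.starProjection.toLinearMap
  have hL : ∀ e : E, Mᗮ.starProjection e ∈ L := by
    intro e
    refine Φ.denseRange_embed.induction_on (p := fun e => Mᗮ.starProjection e ∈ L) e
      (L.closed_of_finiteDimensional.preimage Mᗮ.starProjection.continuous) fun u => ?_
    obtain ⟨f, hf, n, hn, rfl⟩ := Submodule.mem_sup.1 (hFN ▸ Submodule.mem_top : u ∈ F ⊔ N)
    have hfM : Φ.embed f ∈ M := Submodule.le_topologicalClosure _ ⟨f, hf, rfl⟩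
    have h0 : Mᗮ.starProjection (Φ.embed f) = 0 := by
      rw [Submodule.starProjection_apply_eq_zero_iff]
      exact Submodule.le_orthogonal_orthogonal M hfM
    rw [map_add, map_add, h0, zero_add]
    exact ⟨_, ⟨n, hn, rfl⟩, rfl⟩
  refine Submodule.finiteDimensional_of_le (S₂ := L) fun e he => ?_
  rw [← Submodule.starProjection_eq_self_iff.2 he]
  exact hL e

variable [CompleteSpace H] [CompleteSpace E]

/-- With `P` the projection onto the closure of `F` in the completion, `J J† = J P J† + J (1 - P)
J†`. The first term is `(J P)(J P)†`, and the second has finite rank. -/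
theorem exists_resolvent_eq_add {c : ℝ} (hc : 0 ≤ c) (F N : Submodule ℂ T.domain)
    [FiniteDimensional ℂ N] (hFN : F ⊔ N = ⊤)
    (hF : ∀ u ∈ F, c * ‖(u : H)‖ ^ 2 ≤ quadForm T u) :
    ∃ (A : E →L[ℂ] H) (K : H →L[ℂ] H), Φ.resolvent = A ∘L A.adjoint + K ∧
      FiniteDimensional ℂ K.range ∧ ∀ e, ‖A e‖ ^ 2 ≤ (1 + c)⁻¹ * ‖e‖ ^ 2 := by
  have hfin := Φ.finiteDimensional_map_orthogonal F N hFN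
  set M := (F.map Φ.embed).topologicalClosure with hM
  refine ⟨Φ.toBase ∘L M.starProjection, Φ.toBase ∘L Mᗮ.starProjection ∘L Φ.toBase.adjoint,
    ?_, ?_, fun e => ?_⟩
  · have hP : M.starProjection.adjoint = M.starProjection := isSelfAdjoint_starProjection M
    ext g
    simp only [resolvent, ContinuousLinearMap.adjoint_comp, hP, add_apply,
      ContinuousLinearMap.comp_apply]
    rw [← map_add]
    congr 1
    rw [Submodule.starProjection_eq_self_iff.2 (M.starProjection_apply_mem _),
      M.starProjection_add_starProjection_orthogonal]
  · refine Submodule.finiteDimensional_of_le (S₂ := Mᗮ.map Φ.toBase.toLinearMap) ?_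
    rintro _ ⟨g, rfl⟩
    exact ⟨_, Mᗮ.starProjection_apply_mem _, rfl⟩
  · refine (Φ.norm_toBase_sq_le hc hF (M.starProjection_apply_mem e)).trans ?_
    gcongr
    exact M.norm_starProjection_apply_le e

theorem le_re_of_mem_opSpectrum (Φ : FormCompletion T E) (hd : Dense (T.domain : Set H)) (hT : IsNonnegSymmetric T)
    {c : ℝ} (hc : 0 ≤ c) (h : ∀ u : T.domain, c * ‖(u : H)‖ ^ 2 ≤ quadForm T u) {z : ℂ}
    (hz : z ∈ opSpectrum (friedrichs T hT)) : c ≤ z.re := by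
  by_contra! hlt
  refine Φ.notMem_opSpectrum hd hT (isUnit_one_sub_smul_comp_adjoint (c := (1 + c)⁻¹)
    (by positivity) (fun e => ?_) ?_) hz
  · refine Φ.norm_toBase_sq_le hc (F := ⊤) (fun u _ => h u) ?_
    have hdense : Dense (Φ.embed.range : Set E) := Φ.denseRange_embed
    rw [Submodule.map_top, Submodule.dense_iff_topologicalClosure_eq_top.1 hdense]
    trivial
  · rw [mul_inv_lt_iff₀ (by positivity), Complex.add_re, Complex.one_re]
    linarith

/-- Below `c` the operator `1 - (z + 1) R` is invertible plus finite rank, so it can fail to be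
invertible only by having a kernel. Positivity of `R = J J†` then forces its eigenvalue `(z + 1)⁻¹`
to be real and positive. -/
theorem exists_eigenvector {A : E →L[ℂ] H} {K : H →L[ℂ] H} (hK : Φ.resolvent = A ∘L A.adjoint + K)
    [FiniteDimensional ℂ K.range] {c : ℝ} (hc : 0 ≤ c)
    (hA : ∀ e, ‖A e‖ ^ 2 ≤ (1 + c)⁻¹ * ‖e‖ ^ 2) (hd : Dense (T.domain : Set H))
    (hT : IsNonnegSymmetric T) {z : ℂ} (hz : z ∈ opSpectrum (friedrichs T hT)) (hlt : z.re < c) :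
    ∃ w : ℝ, (1 + c)⁻¹ < w ∧ z + 1 = (w : ℂ)⁻¹ ∧
      ∃ v : H, v ≠ 0 ∧ Φ.resolvent v = (w : ℂ) • v := by
  have hS : IsUnit (1 - (z + 1) • (A ∘L A.adjoint)) := by
    refine isUnit_one_sub_smul_comp_adjoint (c := (1 + c)⁻¹) (by positivity) hA ?_
    rw [mul_inv_lt_iff₀ (by positivity), Complex.add_re, Complex.one_re]
    linarith
  have hsum : 1 - (z + 1) • Φ.resolvent = (1 - (z + 1) • (A ∘L A.adjoint)) + -((z + 1) • K) := by
    rw [hK, smul_add]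
    abel
  have hfin : FiniteDimensional ℂ (-((z + 1) • K)).range := by
    refine Submodule.finiteDimensional_of_le (S₂ := K.range) ?_
    rintro _ ⟨g, rfl⟩
    exact K.range.neg_mem (K.range.smul_mem _ ⟨g, rfl⟩)
  obtain ⟨v, hv, hv0⟩ : ∃ v, (1 - (z + 1) • Φ.resolvent) v = 0 ∧ v ≠ 0 := by
    by_contra! h
    refine Φ.notMem_opSpectrum hd hT ?_ hz
    rw [hsum] at h ⊢
    exact isUnit_add_of_finiteDimensional_range hS h
  have hv' : v = (z + 1) • Φ.resolvent v := by
    simpa [sub_eq_zero] using hv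
  have hz0 : z + 1 ≠ 0 := by
    intro h0
    rw [h0, zero_smul] at hv'
    exact hv0 hv'
  have hev : Φ.resolvent v = (z + 1)⁻¹ • v := by
    nth_rw 2 [hv']
    rw [inv_smul_smul₀ hz0]
  have hpos : (0 : ℝ) < ‖v‖ ^ 2 := pow_pos (norm_pos_iff.2 hv0) 2
  have hin : starRingEnd ℂ (z + 1)⁻¹ * ((‖v‖ ^ 2 : ℝ) : ℂ) =
      ((‖Φ.toBase.adjoint v‖ ^ 2 : ℝ) : ℂ) := by
    rw [← inner_comp_adjoint]
    change _ = inner ℂ (Φ.resolvent v) v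
    rw [hev, inner_smul_left, inner_self_eq_norm_sq_to_K]
    simp
  set w : ℝ := ‖Φ.toBase.adjoint v‖ ^ 2 / ‖v‖ ^ 2 with hw
  have hwz : (z + 1)⁻¹ = (w : ℂ) := by
    have h1 : starRingEnd ℂ (z + 1)⁻¹ = (w : ℂ) := by
      rw [hw, Complex.ofReal_div, eq_div_iff (Complex.ofReal_ne_zero.2 hpos.ne'), hin]
    rw [← Complex.conj_conj (z + 1)⁻¹, h1, Complex.conj_ofReal]
  have hw0 : 0 < w := by
    refine lt_of_le_of_ne (by positivity) fun h => ?_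
    rw [← h, Complex.ofReal_zero, inv_eq_zero] at hwz
    exact hz0 hwz
  have hzw : z + 1 = (w : ℂ)⁻¹ := by rw [← hwz, inv_inv]
  refine ⟨w, ?_, hzw, v, hv0, by rw [hev, hwz]⟩
  have hre : z.re + 1 = w⁻¹ := by
    have := congrArg Complex.re hzw
    rwa [← Complex.ofReal_inv, Complex.ofReal_re, Complex.add_re, Complex.one_re] at this
  rw [inv_lt_comm₀ (by positivity) hw0, ← hre]
  linarith

/-- Distinct spectral points give orthogonal eigenvectors of the symmetric resolvent, and `K` maps
these to independent vectors, so their number is at most the rank of `K`. -/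
theorem finite_opSpectrum_lt {A : E →L[ℂ] H} {K : H →L[ℂ] H}
    (hK : Φ.resolvent = A ∘L A.adjoint + K) [FiniteDimensional ℂ K.range] {c : ℝ} (hc : 0 ≤ c)
    (hA : ∀ e, ‖A e‖ ^ 2 ≤ (1 + c)⁻¹ * ‖e‖ ^ 2) (hd : Dense (T.domain : Set H))
    (hT : IsNonnegSymmetric T) :
    {z | z ∈ opSpectrum (friedrichs T hT) ∧ z.re < c}.Finite := by
  choose! w hw hzw v hv0 hv using fun z (hz : z ∈ opSpectrum (friedrichs T hT) ∧ z.re < c) =>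
    Φ.exists_eigenvector hK hc hA hd hT hz.1 hz.2
  let ι := {z // z ∈ opSpectrum (friedrichs T hT) ∧ z.re < c}
  have hsymm : (Φ.resolvent.toLinearMap).IsSymmetric := by
    intro x y
    change inner ℂ (Φ.toBase (Φ.toBase.adjoint x)) y = inner ℂ x (Φ.toBase (Φ.toBase.adjoint y))
    rw [← ContinuousLinearMap.adjoint_inner_right, ContinuousLinearMap.adjoint_inner_left]
  have horth : Orthonormal ℂ fun i : ι => ((‖v i‖⁻¹ : ℝ) : ℂ) • v i := by
    refine ⟨fun i => ?_, fun i j hij => ?_⟩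
    · have := norm_ne_zero_iff.2 (hv0 i i.2)
      simp [norm_smul, this]
    · beta_reduce
      rw [inner_smul_left, inner_smul_right]
      have h1 := hsymm (v i) (v j)
      simp only [ContinuousLinearMap.coe_coe] at h1
      rw [hv i i.2, hv j j.2, inner_smul_left, inner_smul_right, Complex.conj_ofReal] at h1
      have h2 : (w i : ℂ) ≠ w j := by
        intro h
        refine hij (Subtype.ext ?_)
        have := (hzw i i.2).trans ((congrArg _ h).trans (hzw j j.2).symm)
        exact add_right_cancel this
      have h3 : ((w i : ℂ) - w j) * inner ℂ (v i) (v j) = 0 := by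
        rw [sub_mul, h1, sub_self]
      rw [(mul_eq_zero.1 h3).resolve_left (sub_ne_zero.2 h2), mul_zero, mul_zero]
  have hli := linearIndependent_of_eigenvectors hK (c := (1 + c)⁻¹) (by positivity) hA horth
    (w := fun i => w i) (fun i => hw i i.2) fun i => by
      rw [map_smul, hv i i.2, smul_comm]
  have hli2 : LinearIndependent ℂ fun i : ι =>
      (⟨K (((‖v i‖⁻¹ : ℝ) : ℂ) • v i), _, rfl⟩ : K.range) :=
    LinearIndependent.of_comp K.range.subtype hli
  exact Set.finite_coe_iff.1 hli2.finite

theorem le_re_of_mem_essSpectrum {A : E →L[ℂ] H} {K : H →L[ℂ] H}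
    (hK : Φ.resolvent = A ∘L A.adjoint + K) [FiniteDimensional ℂ K.range] {c : ℝ} (hc : 0 ≤ c)
    (hA : ∀ e, ‖A e‖ ^ 2 ≤ (1 + c)⁻¹ * ‖e‖ ^ 2) (hd : Dense (T.domain : Set H))
    (hT : IsNonnegSymmetric T) {z : ℂ} (hz : z ∈ essSpectrum (friedrichs T hT)) : c ≤ z.re := by
  by_contra! hlt
  refine hz.2 ?_
  obtain ⟨w, hw, hzw, v, hv0, hv⟩ := Φ.exists_eigenvector hK hc hA hd hT hz.1 hlt
  have hw0 : w ≠ 0 := ((by positivity : 0 < (1 + c)⁻¹).trans hw).ne'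
  have hwc : (w : ℂ) ≠ 0 := Complex.ofReal_ne_zero.2 hw0
  have hmem : ∀ f : opEigenspace (friedrichs T hT) z,
      Φ.resolvent (f : (friedrichs T hT).domain) = (w : ℂ) • ((f : (friedrichs T hT).domain) : H) := by
    intro f
    have h1 : friedrichs T hT f - z • ((f : (friedrichs T hT).domain) : H) = 0 :=
      LinearMap.mem_ker.1 f.2
    have h2 := Φ.resolvent_friedrichs hd hT f
    have h3 : friedrichs T hT f + ((f : (friedrichs T hT).domain) : H) =
        (w : ℂ)⁻¹ • ((f : (friedrichs T hT).domain) : H) := by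
      rw [sub_eq_zero.1 h1, ← hzw]
      module
    rw [h3, map_smul] at h2
    exact (inv_smul_eq_iff₀ hwc).1 h2
  refine ⟨?_, ?_, ?_⟩
  · obtain ⟨f, hf, hf'⟩ := Φ.friedrichs_resolvent hd hT v
    have hf0 : f ∈ opEigenspace (friedrichs T hT) z := by
      refine LinearMap.mem_ker.2 ?_
      change friedrichs T hT f - z • (f : H) = 0
      have h1 : (w : ℂ)⁻¹ • (f : H) = v := by rw [hf, hv, inv_smul_smul₀ hwc]
      have h2 : friedrichs T hT f - z • (f : H) =
        (friedrichs T hT f + (f : H)) - (z + 1) • (f : H) := by module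
      rw [h2, hf', hzw, h1, sub_self]
    intro hbot
    rw [hbot, Submodule.mem_bot] at hf0
    rw [hf0, hv] at hf
    exact (smul_ne_zero hwc hv0) hf.symm
  -- Finite multiplicity: `K` is injective on the eigenspace, since `K x = 0` gives `w ‖x‖² = ‖A†
  -- x‖² ≤ (1 + c)⁻¹ ‖x‖²` although `w > (1 + c)⁻¹`.
  · let κ : opEigenspace (friedrichs T hT) z →ₗ[ℂ] K.range :=
      K.toLinearMap.rangeRestrict ∘ₗ (friedrichs T hT).domain.subtype ∘ₗ
        (opEigenspace (friedrichs T hT) z).subtype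
    refine FiniteDimensional.of_injective κ ((injective_iff_map_eq_zero κ).2 fun f hf => ?_)
    set x : H := ((f : (friedrichs T hT).domain) : H) with hx
    have hKx : K x = 0 := congrArg Subtype.val hf
    have h1 : inner ℂ (Φ.resolvent x) x = ((‖A.adjoint x‖ ^ 2 : ℝ) : ℂ) := by
      rw [hK, add_apply, hKx, add_zero, inner_comp_adjoint]
    rw [hx, hmem f, ← hx, inner_smul_left, inner_self_eq_norm_sq_to_K, Complex.conj_ofReal] at h1
    have h2 : w * ‖x‖ ^ 2 = ‖A.adjoint x‖ ^ 2 := by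
      have h3 : ((w * ‖x‖ ^ 2 : ℝ) : ℂ) = ((‖A.adjoint x‖ ^ 2 : ℝ) : ℂ) := by
        rw [← h1]
        simp
      exact Complex.ofReal_injective h3
    have h3 := norm_adjoint_sq_le (c := (1 + c)⁻¹) (by positivity) hA x
    have h4 : ‖x‖ ^ 2 = 0 := by
      by_contra hne
      have : 0 < ‖x‖ ^ 2 := lt_of_le_of_ne (sq_nonneg _) (Ne.symm hne)
      nlinarith
    have hx0 : x = 0 := norm_eq_zero.1 (sq_eq_zero_iff.1 h4)
    exact Subtype.ext (Subtype.ext hx0)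
  · have hfin := (Φ.finite_opSpectrum_lt hK hc hA hd hT).subset
      (Set.sdiff_subset (t := {z}))
    have hopen : IsOpen ({z : ℂ | z.re < c} \
        ({z | z ∈ opSpectrum (friedrichs T hT) ∧ z.re < c} \ {z})) :=
      (isOpen_lt Complex.continuous_re continuous_const).sdiff hfin.isClosed
    obtain ⟨ε, hε, hball⟩ := Metric.isOpen_iff.1 hopen z ⟨hlt, fun h => h.2 rfl⟩
    refine ⟨ε, hε, Set.Subset.antisymm (fun y hy => ?_) ?_⟩
    · by_contra hne
      exact (hball hy.2).2 ⟨⟨hy.1, (hball hy.2).1⟩, hne⟩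
    · rintro _ rfl
      exact ⟨hz.1, Metric.mem_ball_self hε⟩

end FormCompletion

variable [CompleteSpace H] {T : H →ₗ.[ℂ] H}

/-- The Friedrichs extension has the lower bound of the operator that it extends. -/
theorem le_specInf_opSpectrum_friedrichs (hd : Dense (T.domain : Set H))
    (hT : IsNonnegSymmetric T) {c : ℝ} (hc : 0 ≤ c)
    (h : ∀ u : T.domain, c * ‖(u : H)‖ ^ 2 ≤ quadForm T u) :
    (c : EReal) ≤ specInf (opSpectrum (friedrichs T hT)) :=
  le_specInf fun _ hz =>
    (FormNormedDomain.formCompletion (hT := hT)).le_re_of_mem_opSpectrum hd hT hc h hz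

/-- A lower bound of the form on a subspace of finite codimension of the domain is a lower bound
of the essential spectrum of the Friedrichs extension. -/
theorem le_specInf_essSpectrum_friedrichs (hd : Dense (T.domain : Set H))
    (hT : IsNonnegSymmetric T) {c : ℝ} (hc : 0 ≤ c) (F N : Submodule ℂ T.domain)
    [FiniteDimensional ℂ N] (hFN : F ⊔ N = ⊤)
    (hF : ∀ u ∈ F, c * ‖(u : H)‖ ^ 2 ≤ quadForm T u) :
    (c : EReal) ≤ specInf (essSpectrum (friedrichs T hT)) := by
  obtain ⟨A, K, hK, hfin, hA⟩ :=
    (FormNormedDomain.formCompletion (hT := hT)).exists_resolvent_eq_add hc F N hFN hF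
  exact le_specInf fun _ hz => FormCompletion.le_re_of_mem_essSpectrum _ hK hc hA hd hT hz

end FriedrichsSpectrum

/-! ### Finitely supported functions in the weighted space. -/

section WeightedL2Lemmas

variable {X : Type*} {m : X → ℝ}

theorem WeightedL2.norm_sq_eq_sum (hm : ∀ x, 0 < m x) (f : WeightedL2 m) (s : Finset X)
    (hs : ∀ x ∉ s, f x = 0) : ‖f‖ ^ 2 = ∑ x ∈ s, m x * ‖f x‖ ^ 2 := by
  have h := WeightedL2.inner_eq_sum hm f f s hs
  rw [inner_self_eq_norm_sq_to_K] at h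
  have h2 := congrArg Complex.re h
  rw [Complex.re_sum] at h2
  convert h2 using 1
  · norm_cast
  · refine Finset.sum_congr rfl fun x _ => ?_
    rw [Complex.conj_mul', ← Complex.ofReal_pow, ← Complex.ofReal_mul, Complex.ofReal_re]

theorem dense_finSupp (hm : ∀ x, 0 < m x) : Dense (finSupp hm : Set (WeightedL2 m)) := by
  classical
  rw [Submodule.dense_iff_topologicalClosure_eq_top, Submodule.topologicalClosure_eq_top_iff,
    Submodule.eq_bot_iff]
  intro g hg
  have h0 : ∀ x, g x = 0 := by
    intro x
    have hsupp : (Function.support (Pi.single x 1 : X → ℂ)).Finite :=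
      (Set.finite_singleton x).subset Pi.support_single_subset
    set d : WeightedL2 m := (memLp_of_finite_support m hsupp).toLp _ with hd
    have hdx : ∀ y, d y = (Pi.single x 1 : X → ℂ) y := fun y =>
      weightMeasure_ae hm (MeasureTheory.MemLp.coeFn_toLp (memLp_of_finite_support m hsupp)) y
    have hdmem : d ∈ finSupp hm := by
      change (Function.support fun y => d y).Finite
      rw [funext hdx]
      exact hsupp
    have h1 := hg d hdmem
    rw [WeightedL2.inner_eq_sum hm d g {x} (fun y hy => by
      rw [hdx, Pi.single_eq_of_ne (by simpa using hy)]), Finset.sum_singleton, hdx,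
      Pi.single_eq_same, map_one, one_mul] at h1
    exact (mul_eq_zero.1 h1).resolve_left (Complex.ofReal_ne_zero.2 (hm x).ne')
  refine MeasureTheory.Lp.ext (Filter.Eventually.of_forall fun x => ?_)
  rw [h0, WeightedL2.coe_zero hm]

theorem quadForm_minimalOp (hm : ∀ x, 0 < m x) (L : (X → ℂ) →ₗ[ℂ] (X → ℂ))
    (hL : ∀ f : X → ℂ, f.support.Finite → (L f).support.Finite)
    (u : (minimalOp hm L hL).domain) (s : Finset X) (hs : ∀ x ∉ s, (u : WeightedL2 m) x = 0) :
    quadForm (minimalOp hm L hL) u = (∑ x ∈ s, (m x : ℂ) *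
      (starRingEnd ℂ ((u : WeightedL2 m) x) * L (fun x => (u : WeightedL2 m) x) x)).re := by
  rw [quadForm, WeightedL2.inner_eq_sum hm _ _ s hs]
  simp only [minimalOp_apply]

theorem exists_finset_support (hm : ∀ x, 0 < m x) {u : WeightedL2 m} (hu : u ∈ finSupp hm) :
    ∃ s : Finset X, (∀ x ∉ s, u x = 0) ∧ ∀ x ∈ s, u x ≠ 0 := by
  have hu' : (Function.support fun x => u x).Finite := hu
  refine ⟨hu'.toFinset, fun x hx => ?_, fun x hx => ?_⟩
  · simpa using hx
  · simpa using hx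

end WeightedL2Lemmas

/-! ### Energy bounds from positive supersolutions. -/

namespace WeightedGraph

variable {V : Type*} (G : WeightedGraph V)

/-- A positive supersolution `Δ W ≥ c W` on the support of `f` bounds the energy of `f` below. -/
theorem le_re_sum_lapLinear {W : V → ℝ} (hW : ∀ x, 0 < W x) {c : ℝ} (s : Finset V) {f : V → ℂ}
    (hs : ∀ x ∉ s, f x = 0) (hc : ∀ x ∈ s, c * W x ≤ G.algLaplacian W x) :
    c * ∑ x ∈ s, G.m x * ‖f x‖ ^ 2 ≤
      (∑ x ∈ s, (G.m x : ℂ) * (starRingEnd ℂ (f x) * G.lapLinear f x)).re := by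
  classical
  let a : V → V → ℝ := fun x y => G.E x y * (‖f x‖ ^ 2 * (W y / W x))
  have ha : ∀ x y, 0 ≤ a x y := fun x y => mul_nonneg (G.E_nonneg x y)
    (mul_nonneg (sq_nonneg _) (div_nonneg (hW y).le (hW x).le))
  let t : Finset V := s ∪ s.biUnion G.nbr
  have hst : s ⊆ t := Finset.subset_union_left
  have hnt : ∀ x ∈ s, G.nbr x ⊆ t := fun x hx y hy =>
    Finset.mem_union_right _ (Finset.mem_biUnion.2 ⟨x, hx, hy⟩)
  -- The terms `a y x` with `y` outside `s` vanish because `f y = 0`. On `s × s` the two sums agree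
  -- by exchanging variables, and the remaining terms `a x y` are nonnegative.
  have hsum : ∑ x ∈ s, ∑ y ∈ t, a y x ≤ ∑ x ∈ s, ∑ y ∈ t, a x y :=
    calc ∑ x ∈ s, ∑ y ∈ t, a y x = ∑ x ∈ s, ∑ y ∈ s, a y x :=
          Finset.sum_congr rfl fun x _ => (Finset.sum_subset hst fun y _ hy => by
            simp [a, hs y hy]).symm
      _ = ∑ x ∈ s, ∑ y ∈ s, a x y := Finset.sum_comm
      _ ≤ ∑ x ∈ s, ∑ y ∈ t, a x y := Finset.sum_le_sum fun x _ =>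
          Finset.sum_le_sum_of_subset_of_nonneg hst fun y _ _ => ha x y
  have hpt : ∀ x ∈ s, c * (G.m x * ‖f x‖ ^ 2) + 1 / 2 * ((∑ y ∈ t, a x y) - ∑ y ∈ t, a y x) ≤
      ((G.m x : ℂ) * (starRingEnd ℂ (f x) * G.lapLinear f x)).re := by
    intro x hx
    have hm := G.m_pos x
    have h1 : ((G.m x : ℂ) * (starRingEnd ℂ (f x) * G.lapLinear f x)).re =
        ∑ y ∈ t, G.E x y * (‖f x‖ ^ 2 - (starRingEnd ℂ (f x) * f y).re) := by
      have hl : (G.m x : ℂ) * G.lapLinear f x = ∑ y ∈ t, (G.E x y : ℂ) * (f x - f y) := by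
        change (G.m x : ℂ) * ((G.m x)⁻¹ • ∑ y ∈ G.nbr x, G.E x y • (f x - f y)) = _
        rw [Complex.real_smul, Complex.ofReal_inv,
          mul_inv_cancel_left₀ (Complex.ofReal_ne_zero.2 hm.ne'),
          ← Finset.sum_subset (hnt x hx) fun y _ hy => by simp [G.E_eq_zero hy]]
        exact Finset.sum_congr rfl fun y _ => Complex.real_smul
      rw [mul_left_comm, hl, Finset.mul_sum, Complex.re_sum]
      refine Finset.sum_congr rfl fun y _ => ?_
      rw [mul_left_comm, Complex.re_ofReal_mul, mul_sub, Complex.conj_mul', Complex.sub_re,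
        ← Complex.ofReal_pow, Complex.ofReal_re]
    have h2 : G.m x * G.algLaplacian W x = ∑ y ∈ t, G.E x y * (W x - W y) := by
      rw [algLaplacian, smul_eq_mul, mul_inv_cancel_left₀ hm.ne',
        ← Finset.sum_subset (hnt x hx) fun y _ hy => by simp [G.E_eq_zero hy]]
      rfl
    have h3 : c * (G.m x * ‖f x‖ ^ 2) ≤ ∑ y ∈ t, G.E x y * (‖f x‖ ^ 2 * (1 - W y / W x)) := by
      have h4 : ∑ y ∈ t, G.E x y * (‖f x‖ ^ 2 * (1 - W y / W x)) =
          ‖f x‖ ^ 2 / W x * (G.m x * G.algLaplacian W x) := by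
        rw [h2, Finset.mul_sum]
        refine Finset.sum_congr rfl fun y _ => ?_
        have := (hW x).ne'
        field_simp
      rw [h4]
      have h5 := mul_le_mul_of_nonneg_left (hc x hx)
        (mul_nonneg (div_nonneg (sq_nonneg ‖f x‖) (hW x).le) hm.le)
      have h6 : ‖f x‖ ^ 2 / W x * G.m x * (c * W x) = c * (G.m x * ‖f x‖ ^ 2) := by
        have := (hW x).ne'
        field_simp
      rw [h6] at h5
      linarith
    rw [h1, ← Finset.sum_sub_distrib, Finset.mul_sum]
    refine (add_le_add_left h3 _).trans ?_
    rw [← Finset.sum_add_distrib]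
    refine Finset.sum_le_sum fun y _ => ?_
    have h7 : (starRingEnd ℂ (f x) * f y).re ≤ ‖f x‖ * ‖f y‖ := by
      refine (Complex.re_le_norm _).trans ?_
      rw [norm_mul, Complex.norm_conj]
    -- Arithmetic–geometric mean inequality weighted by `W`. It is chosen so that the diagonal part
    -- rebuilds `ΔW / W` and the rest is antisymmetric in `x` and `y`.
    have h8 : 2 * (‖f x‖ * ‖f y‖) ≤ ‖f x‖ ^ 2 * (W y / W x) + ‖f y‖ ^ 2 * (W x / W y) := by
      have hx := hW x
      have hy := hW y
      have h9 : ‖f x‖ ^ 2 * (W y / W x) + ‖f y‖ ^ 2 * (W x / W y) - 2 * (‖f x‖ * ‖f y‖) =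
          (‖f x‖ * W y - ‖f y‖ * W x) ^ 2 / (W x * W y) := by
        field_simp
        ring
      have : 0 ≤ (‖f x‖ * W y - ‖f y‖ * W x) ^ 2 / (W x * W y) := by positivity
      linarith
    have h10 := mul_nonneg (G.E_nonneg x y) (sub_nonneg.2 (h7.trans (by linarith :
      ‖f x‖ * ‖f y‖ ≤ 1 / 2 * (‖f x‖ ^ 2 * (W y / W x) + ‖f y‖ ^ 2 * (W x / W y)))))
    simp only [a, G.E_symm y x]
    linarith
  rw [Complex.re_sum]
  refine le_trans ?_ (Finset.sum_le_sum hpt)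
  rw [Finset.sum_add_distrib, ← Finset.mul_sum, ← Finset.mul_sum, Finset.sum_sub_distrib]
  linarith

theorem le_quadForm_minDirichletLaplacian {W : V → ℝ} (hW : ∀ x, 0 < W x) {c : ℝ} {U : Set V}
    (hc : ∀ x ∈ U, c * W x ≤ G.algLaplacian W x) (u : (G.minDirichletLaplacian U).domain) :
    c * ‖(u : WeightedL2 fun x : U => G.m x)‖ ^ 2 ≤ quadForm (G.minDirichletLaplacian U) u := by
  obtain ⟨s, hs, -⟩ := exists_finset_support (fun x : U => G.m_pos x) u.2
  have h1 := quadForm_minimalOp (fun x : U => G.m_pos x) (G.dirichletLinear U)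
    (G.dirichletLinear_support U) u s hs
  have h2 := WeightedL2.norm_sq_eq_sum (fun x : U => G.m_pos x) _ s hs
  set f : U → ℂ := fun x => (u : WeightedL2 fun x : U => G.m x) x with hf
  have h3 := G.le_re_sum_lapLinear hW (c := c) (s.map (Function.Embedding.subtype _))
    (f := extendZero U f) (fun x hx => ?_) (fun x hx => ?_)
  · rw [Finset.sum_map, Finset.sum_map] at h3
    simp only [Function.Embedding.subtype_apply, extendZero_apply] at h3
    rw [h2]
    exact h3.trans_eq h1.symm
  · by_cases hU : x ∈ U
    · refine (extendZero_apply f ⟨x, hU⟩).trans (hs _ fun h => hx ?_)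
      exact Finset.mem_map.2 ⟨⟨x, hU⟩, h, rfl⟩
    · exact extendZero_apply_of_notMem f hU
  · obtain ⟨y, -, rfl⟩ := Finset.mem_map.1 hx
    exact hc _ y.2

theorem le_quadForm_minLaplacian {W : V → ℝ} (hW : ∀ x, 0 < W x) {c : ℝ} {U : Set V}
    (hc : ∀ x ∈ U, c * W x ≤ G.algLaplacian W x) (u : G.minLaplacian.domain)
    (hu : ∀ x ∉ U, (u : WeightedL2 G.m) x = 0) :
    c * ‖(u : WeightedL2 G.m)‖ ^ 2 ≤ quadForm G.minLaplacian u := by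
  obtain ⟨s, hs, hs'⟩ := exists_finset_support G.m_pos u.2
  rw [WeightedL2.norm_sq_eq_sum G.m_pos _ s hs]
  refine (G.le_re_sum_lapLinear hW s hs fun x hx => hc x ?_).trans_eq
    (quadForm_minimalOp G.m_pos G.lapLinear G.lapLinear_support u s hs).symm
  by_contra hxU
  exact hs' x hx (hu x hxU)

/-- Evaluation of finitely supported functions on a set. -/
def evalOn (B : Set V) : G.minLaplacian.domain →ₗ[ℂ] (B → ℂ) where
  toFun u x := (u : WeightedL2 G.m) x
  map_add' _ _ := funext fun x => WeightedL2.coe_add G.m_pos _ _ x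
  map_smul' c _ := funext fun x => WeightedL2.coe_smul G.m_pos c _ x

theorem le_specInf_dirichletLaplacian {W : V → ℝ} (hW : ∀ x, 0 < W x) {c : ℝ} (hc0 : 0 ≤ c)
    {U : Set V} (hc : ∀ x ∈ U, c * W x ≤ G.algLaplacian W x) :
    (c : EReal) ≤ specInf (opSpectrum (G.dirichletLaplacian U)) :=
  le_specInf_opSpectrum_friedrichs (dense_finSupp fun x : U => G.m_pos x) _ hc0
    (G.le_quadForm_minDirichletLaplacian hW hc)

theorem le_specInf_essSpectrum_laplacian {W : V → ℝ} (hW : ∀ x, 0 < W x) {c : ℝ} (hc0 : 0 ≤ c)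
    {B : Set V} (hB : B.Finite) (hc : ∀ x ∈ Bᶜ, c * W x ≤ G.algLaplacian W x) :
    (c : EReal) ≤ specInf (essSpectrum G.laplacian) := by
  have : Finite B := hB
  -- Functions vanishing on the finite set `B` form the kernel of a map into a finite-dimensional
  -- space, so any complement `N` is finite-dimensional.
  obtain ⟨N, hN⟩ := Submodule.exists_isCompl (G.evalOn B).ker
  have : FiniteDimensional ℂ N := by
    refine FiniteDimensional.of_injective (G.evalOn B ∘ₗ N.subtype)
      ((injective_iff_map_eq_zero _).2 fun u hu => ?_)
    exact Subtype.ext ((Submodule.disjoint_def.1 hN.disjoint) u (LinearMap.mem_ker.2 hu) u.2)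
  refine le_specInf_essSpectrum_friedrichs (dense_finSupp G.m_pos) _ hc0 _ N hN.sup_eq_top
    fun u hu => G.le_quadForm_minLaplacian hW hc u fun x hx => ?_
  exact congrFun (LinearMap.mem_ker.1 hu) ⟨x, not_not.1 hx⟩

/-! ### Radial functions and the geometric supersolution. -/

namespace OneDimDecomposition

variable {G} (P : G.OneDimDecomposition)

theorem mem_S_iff {x : V} {n : ℕ} : x ∈ P.S n ↔ P.level x = n :=
  ⟨fun h => ((P.partition x).choose_spec.2 n h).symm, fun h => h ▸ (P.partition x).choose_spec.1⟩

theorem mem_ball_iff {x : V} {n : ℕ} : x ∈ P.ball n ↔ P.level x ≤ n := by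
  simp [ball, mem_S_iff]

theorem finite_ball (n : ℕ) : (P.ball n).Finite :=
  (Finset.Icc 0 n).finite_toSet.biUnion fun i _ => (P.S i).finite_toSet

theorem degPlus_nonneg (x : V) : 0 ≤ P.degPlus x :=
  div_nonneg (Finset.sum_nonneg fun y _ => G.E_nonneg x y) (G.m_pos x).le

theorem degMinus_nonneg (x : V) : 0 ≤ P.degMinus x := by
  rw [degMinus]
  split_ifs
  · exact le_rfl
  · exact div_nonneg (Finset.sum_nonneg fun y _ => G.E_nonneg x y) (G.m_pos x).le

/-- The Laplacian of a radial function. -/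
theorem algLaplacian_radial (w : ℕ → ℝ) (x : V) :
    G.algLaplacian (fun y => w (P.level y)) x =
      P.degPlus x * (w (P.level x) - w (P.level x + 1)) +
      P.degMinus x * (w (P.level x) - w (P.level x - 1)) := by
  classical
  have hS : ∀ k, ∑ y ∈ G.nbr x, (if y ∈ P.S k then G.E x y else 0) = ∑ y ∈ P.S k, G.E x y := by
    intro k
    rw [Finset.sum_ite_mem]
    refine Finset.sum_subset Finset.inter_subset_right fun y hy hy' => G.E_eq_zero fun h => hy' ?_
    exact Finset.mem_inter.2 ⟨h, hy⟩
  have hterm : ∀ y ∈ G.nbr x, G.E x y • (w (P.level x) - w (P.level y)) =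
      (if y ∈ P.S (P.level x + 1) then G.E x y else 0) * (w (P.level x) - w (P.level x + 1)) +
      (if P.level x = 0 then 0 else if y ∈ P.S (P.level x - 1) then G.E x y else 0) *
        (w (P.level x) - w (P.level x - 1)) := by
    intro y hy
    have hpos : 0 < G.E x y := by simpa [nbr] using hy
    have h := P.edge _ _ x y (P.mem_S_iff.2 rfl) (P.mem_S_iff.2 rfl) hpos
    simp only [mem_S_iff, smul_eq_mul]
    rcases (by omega : P.level y = P.level x ∨ P.level y = P.level x + 1 ∨
      (P.level x ≠ 0 ∧ P.level y = P.level x - 1)) with h1 | h1 | ⟨h0, h1⟩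
    · rw [if_neg (by omega), h1]
      by_cases h0 : P.level x = 0
      · simp [h0]
      · rw [if_neg h0, if_neg (by omega)]
        simp
    · rw [if_pos h1, if_neg (by omega : ¬ P.level y = P.level x - 1), h1]
      simp
    · rw [if_neg (by omega), if_neg h0, if_pos h1, h1]
      simp
  rw [algLaplacian, Finset.sum_congr rfl hterm, Finset.sum_add_distrib, ← Finset.sum_mul,
    ← Finset.sum_mul, hS, degPlus, degMinus]
  by_cases h0 : P.level x = 0
  · simp only [h0, if_true, Finset.sum_const_zero, smul_eq_mul]
    ring
  · simp only [h0, if_false, hS, smul_eq_mul]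
    ring

/-- If `deg₋` vanishes outside a ball then so does `deg₊`. -/
theorem degPlus_eq_zero {n : ℕ} (h : ∀ x ∈ (P.ball n)ᶜ, P.degMinus x = 0) {x : V}
    (hx : x ∈ (P.ball n)ᶜ) : P.degPlus x = 0 := by
  rw [degPlus, Finset.sum_eq_zero, zero_div]
  intro y hy
  rw [mem_S_iff] at hy
  rw [Set.mem_compl_iff, mem_ball_iff] at hx
  have hy' : y ∈ (P.ball n)ᶜ := by
    rw [Set.mem_compl_iff, mem_ball_iff]
    omega
  have h1 := h y hy'
  rw [degMinus, if_neg (by omega), div_eq_zero_iff, or_iff_left (G.m_pos y).ne',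
    Finset.sum_eq_zero_iff_of_nonneg fun z _ => G.E_nonneg y z] at h1
  rw [G.E_symm]
  exact h1 x (P.mem_S_iff.2 (by omega))

end OneDimDecomposition

/-- The optimal decay rate of a radial supersolution. -/
theorem exists_decay_rate {a D : ℝ} (ha : 0 ≤ a) (h : a < D ∨ (a = 0 ∧ D = 0)) :
    ∃ t : ℝ, 0 < t ∧ t ≤ 1 ∧ ∀ p q : ℝ, a ≤ p - q → p + q ≤ D →
      D - √(D ^ 2 - a ^ 2) ≤ p * (1 - t) + q * (1 - t⁻¹) := by
  rcases h with h | ⟨rfl, rfl⟩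
  · have hpos : 0 < D ^ 2 - a ^ 2 := by nlinarith
    have hsq := Real.sq_sqrt hpos.le
    have hr := Real.sqrt_pos.2 hpos
    set r := √(D ^ 2 - a ^ 2)
    have hrD : r ≤ D := abs_le_of_sq_le_sq' (by nlinarith) (by linarith) |>.2
    have hDr : D - a ≤ r := abs_le_of_sq_le_sq' (by nlinarith) hr.le |>.2
    have hinv : ((D - a) / r)⁻¹ = (D + a) / r := by
      rw [inv_div, div_eq_div_iff (by linarith) hr.ne']
      nlinarith
    -- As `r² = (D - a)(D + a)`, this ratio is `√((D - a) / (D + a))`, and its inverse `(D + a) / r`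
    -- has the same denominator.
    refine ⟨(D - a) / r, div_pos (by linarith) hr, (div_le_one hr).2 hDr, fun p q h1 h2 => ?_⟩
    rw [hinv]
    have h3 : p * (1 - (D - a) / r) + q * (1 - (D + a) / r) =
        ((p + q) * (r - D) + (p - q) * a) / r := by
      field_simp
      ring
    rw [h3, le_div_iff₀ hr]
    -- Since `r ≤ D` and `0 ≤ a`, the numerator is at least `D (r - D) + a² = r (D - r)`.
    nlinarith [mul_nonneg (sub_nonneg.2 h2) (sub_nonneg.2 hrD),
      mul_nonneg (sub_nonneg.2 h1) ha]
  · refine ⟨1, one_pos, le_rfl, fun p q h1 h2 => ?_⟩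
    simp

namespace OneDimDecomposition

variable {G} (P : G.OneDimDecomposition)

/-- The function equal to `1` on a ball that decays geometrically outside is a supersolution. -/
theorem algLaplacian_geometric {n₀ : ℕ} {c t : ℝ} (ht : 0 < t) (ht1 : t ≤ 1)
    (h : ∀ x ∈ (P.ball n₀)ᶜ, c ≤ P.degPlus x * (1 - t) + P.degMinus x * (1 - t⁻¹)) (x : V) :
    (P.ball n₀)ᶜ.indicator (fun _ => c) x * t ^ (P.level x - n₀) ≤
      G.algLaplacian (fun y => t ^ (P.level y - n₀)) x := by
  rw [P.algLaplacian_radial fun n => t ^ (n - n₀)]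
  by_cases hx : x ∈ P.ball n₀
  · rw [Set.indicator_of_notMem (by simpa using hx), zero_mul]
    rw [mem_ball_iff] at hx
    -- Truncated subtraction makes the function `1` on the ball, so the inward difference vanishes;
    -- the outward one is nonnegative because `t ≤ 1`.
    rw [(by omega : P.level x - n₀ = 0), (by omega : P.level x - 1 - n₀ = 0)]
    have h1 : t ^ (P.level x + 1 - n₀) ≤ 1 := pow_le_one₀ ht.le ht1
    have h2 := mul_nonneg (P.degPlus_nonneg x) (sub_nonneg.2 h1)
    simpa using h2
  · rw [Set.indicator_of_mem (by simpa using hx)]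
    refine (mul_le_mul_of_nonneg_right (h x hx) (pow_pos ht (P.level x - n₀)).le).trans_eq ?_
    rw [mem_ball_iff] at hx
    obtain ⟨k, hk⟩ : ∃ k, P.level x = n₀ + k + 1 := ⟨P.level x - n₀ - 1, by omega⟩
    rw [hk, (by omega : n₀ + k + 1 - n₀ = k + 1), (by omega : n₀ + k + 1 + 1 - n₀ = k + 2),
      (by omega : n₀ + k + 1 - 1 - n₀ = k)]
    field_simp
    ring

end OneDimDecomposition

end WeightedGraph

/-! ### The supersolution and the spectral bounds. -/

open WeightedGraph in
theorem exists_supersolution {V : Type*} (G : WeightedGraph V) (P : G.OneDimDecomposition)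
    (n₀ : ℕ) (a D : ℝ) (ha : 0 ≤ a)
    (h_diff : ∀ x ∈ (P.ball n₀)ᶜ, a ≤ P.degPlus x - P.degMinus x)
    (h_sum : ∀ x ∈ (P.ball n₀)ᶜ, P.degPlus x + P.degMinus x ≤ D) :
    ∃ W : V → ℝ, (∀ x, 0 < W x) ∧
      ∀ x, (P.ball n₀)ᶜ.indicator (fun _ => D - √(D ^ 2 - a ^ 2)) x * W x ≤
        G.algLaplacian W x := by
  rcases (P.ball n₀)ᶜ.eq_empty_or_nonempty with he | ⟨x, hx⟩
  · refine ⟨fun _ => 1, fun _ => one_pos, fun x => ?_⟩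
    simp [he, algLaplacian]
  -- If `D ≤ a`, the hypotheses force `deg₋ = 0` outside the ball. By symmetry of the edge weights
  -- `deg₊` vanishes there too, which leaves only `a = D = 0`.
  · have hrate : a < D ∨ (a = 0 ∧ D = 0) := by
      by_contra! hne
      have hD : D ≤ a := hne.1
      have h0 : ∀ y ∈ (P.ball n₀)ᶜ, P.degMinus y = 0 := fun y hy => by
        linarith [h_diff y hy, h_sum y hy, P.degMinus_nonneg y]
      have h1 := P.degPlus_eq_zero h0 hx
      have h2 := h_diff x hx
      have h3 := h_sum x hx
      rw [h1, h0 x hx] at h2 h3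
      exact hne.2 (by linarith) (by linarith)
    obtain ⟨t, ht, ht1, h⟩ := exists_decay_rate ha hrate
    exact ⟨_, fun y => pow_pos ht _, P.algLaplacian_geometric ht ht1 fun y hy =>
      h _ _ (h_diff y hy) (h_sum y hy)⟩

end

theorem mainTheorem5 {V : Type*} [Countable V] (G : WeightedGraph V) (P : G.OneDimDecomposition)
    (n₀ : ℕ) (a D : ℝ) (ha : 0 ≤ a)
    (h_diff : ∀ x ∈ (P.ball n₀)ᶜ, a ≤ P.degPlus x - P.degMinus x)
    (h_sum : ∀ x ∈ (P.ball n₀)ᶜ, P.degPlus x + P.degMinus x ≤ D) :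
    (∃ W : V → ℝ, (∀ x, 0 < W x) ∧
      ∀ x, (P.ball n₀)ᶜ.indicator (fun _ => D - √(D ^ 2 - a ^ 2)) x * W x ≤
        G.algLaplacian W x) ∧
    (∀ x, 0 ≤ (P.ball n₀)ᶜ.indicator (fun _ => D - √(D ^ 2 - a ^ 2)) x) ∧
    (∀ n, n₀ ≤ n → ((D - √(D ^ 2 - a ^ 2) : ℝ) : EReal) ≤
      specInf (opSpectrum (G.dirichletLaplacian (P.ball n)ᶜ))) ∧
    ((D - √(D ^ 2 - a ^ 2) : ℝ) : EReal) ≤ specInf (essSpectrum G.laplacian) := by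
  have hsuper := exists_supersolution G P n₀ a D ha h_diff h_sum
  have hnonneg : ∀ x ∈ (P.ball n₀)ᶜ, 0 ≤ D - √(D ^ 2 - a ^ 2) := fun x hx => by
    have hD : 0 ≤ D := by
      linarith [h_sum x hx, P.degPlus_nonneg x, P.degMinus_nonneg x]
    exact sub_nonneg.2 (Real.sqrt_le_iff.2 ⟨hD, sub_le_self _ (sq_nonneg a)⟩)
  refine ⟨hsuper, fun x => Set.indicator_nonneg hnonneg x, ?_⟩
  obtain ⟨W, hW, hWx⟩ := hsuper
  -- When the ball is all of `V`, nothing constrains `D` and the constant may be negative. The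
  -- maximum with `0` supplies the nonnegative constant that the spectral lemmas require and changes
  -- nothing when the complement is nonempty.
  have hmax : ∀ x ∈ (P.ball n₀)ᶜ, max (D - √(D ^ 2 - a ^ 2)) 0 * W x ≤ G.algLaplacian W x := by
    intro x hx
    have h := hWx x
    rwa [Set.indicator_of_mem hx, ← max_eq_left (hnonneg x hx)] at h
  have hle : ((D - √(D ^ 2 - a ^ 2) : ℝ) : EReal) ≤ (max (D - √(D ^ 2 - a ^ 2)) 0 : ℝ) :=
    EReal.coe_le_coe_iff.2 (le_max_left _ _)
  refine ⟨fun n hn => hle.trans ?_, hle.trans ?_⟩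
  · refine G.le_specInf_dirichletLaplacian hW (le_max_right _ _) fun x hx => hmax x fun h => hx ?_
    rw [P.mem_ball_iff] at h ⊢
    exact h.trans hn
  · exact G.le_specInf_essSpectrum_laplacian hW (le_max_right _ _) (P.finite_ball n₀) hmax
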